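/- Let $(\boldsymbol X,\boldsymbol Y,\boldsymbol Z)$ be a random vector in $\mathbb R^{d_X}\times\mathbb R^{d_Y}\times\mathbb R^{d_Z}$ whose law $\mu$ has a density $p_{\boldsymbol X,\boldsymbol Y,\boldsymbol Z}$ with respect to Lebesgue measure, and let $Q(\cdot\mid \boldsymbol z)$ be a (known) regular version of the conditional distribution of $\boldsymbol X$ given $\boldsymbol Z=\boldsymbol z$. Marginal densities are denoted by $p_{\boldsymbol X,\boldsymbol Z}$, $p_{\boldsymbol Y,\boldsymbol Z}$, etc., and $\|\cdot\|$ is the Euclidean norm. Consider $$H_0:\ \boldsymbol X\perp\!\!\!\perp\boldsymbol Y\mid\boldsymbol Z\qquad\text{versus}\qquad H_1:\ \boldsymbol X\not\perp\!\!\!\perp\boldsymbol Y\mid\boldsymbol Z .$$ **Statistic.** For finite measures $P,P'$ on $\mathbb R^{d_X}$ let $$\Theta^2(P,P')=\iint \bigl(P(\bar B(\boldsymbol u,\|\boldsymbol v-\boldsymbol u\|))-P'(\bar B(\boldsymbol u,\|\boldsymbol v-\boldsymbol u\|))\bigr)^2\{dP(\boldsymbol u)\,dP(\boldsymbol v)+dP'(\boldsymbol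 u)\,dP'(\boldsymbol v)\}$$ be the ball divergence, where $\bar B(\boldsymbol u,r)$ is the closed ball with center $\boldsymbol u$ and radius $r$. Fix a bounded measurable weight function $a:\mathbb R^{d_Y}\times\mathbb R^{d_Z}\to[0,\infty)$ that is positive where $p_{\boldsymbol Y,\boldsymbol Z}>0$, measurable kernel profiles $K_1,K_2\ge 0$ (for dimension $d_Y+d_Z$ and dimension $d_Z$, respectively), and bandwidths $h_1,h_2>0$ depending on $n$. For a data set $\mathcal D=\{(\boldsymbol x_i,\boldsymbol y_i,\boldsymbol z_i)\}_{i=1}^n$ put $$\tilde P_{\boldsymbol y,\boldsymbol z}=\frac{\sum_i K_1\bigl(\|(\boldsymbol y,\boldsymbol z)-(\boldsymbol y_i,\boldsymbol z_i)\|/h_1\bigr)\,\delta_{\boldsymbol x_i}}{\sum_i K_1\bigl(\|(\boldsymbol y,\boldsymbol z)-(\boldsymbol y_i,\boldsymbol z_i)\|/h_1\bigr)},\qquad \tilde P_{\boldsymbol z}=\frac{\sum_i K_2\bigl(\|\boldsymbol z-\boldsymbol z_i\|/h_2\bigr)\,\delta_{\boldsymbol x_i}}{\sum_i K_2\bigl(\|\boldsymbol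 z-\boldsymbol z_i\|/h_2\bigr)}$$ (with $0/0=0$) and $$\hat\zeta_n(\mathcal D)=\frac1n\sum_{s=1}^n\Theta^2\bigl(\tilde P_{\boldsymbol y_s,\boldsymbol z_s},\tilde P_{\boldsymbol z_s}\bigr)\,a(\boldsymbol y_s,\boldsymbol z_s).$$ **Test.** Let $\mathcal D_0=\{(\boldsymbol X_i,\boldsymbol Y_i,\boldsymbol Z_i)\}_{i=1}^n$ be i.i.d. from $\mu$. Given $\mathcal D_0$, generate independently for $j=1,\dots,M$ and $i=1,\dots,n$ variables $\boldsymbol X^{(j)}_i\sim Q(\cdot\mid\boldsymbol Z_i)$, let $\mathcal D_j'=\{(\boldsymbol X_i^{(j)},\boldsymbol Y_i,\boldsymbol Z_i)\}_{i=1}^n$, and put $$p_{CRT}=\frac{1+\sum_{j=1}^M\mathbf 1\{\hat\zeta_n(\mathcal D_j')\ge\hat\zeta_n(\mathcal D_0)\}}{1+M},\qquad \phi_{CRT}=\mathbf 1\{p_{CRT}<\alpha\},\qquad \alpha\in(0,1).$$ **Assumptions.** Call a nonnegative function $f(\boldsymbol x,\boldsymbol y)$ *nice with respect to $\boldsymbol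 y$* if $\partial f/\partial\boldsymbol y$ exists at $f(\boldsymbol x,\boldsymbol y)\,d\boldsymbol x$-almost every $\boldsymbol x$ for every $\boldsymbol y$ and, for every sequence $\delta_n\to0$ of nonzero reals, $$\sup_{\|\boldsymbol u\|=1}\limsup_{n\to\infty}\int\left(\frac1{\delta_n^2}\left\{\frac{f(\boldsymbol x,\boldsymbol y+\delta_n\boldsymbol u)}{f(\boldsymbol x,\boldsymbol y)}-1-\delta_n\frac{\partial_{\boldsymbol y}f(\boldsymbol x,\boldsymbol y)}{f(\boldsymbol x,\boldsymbol y)}\boldsymbol u^\top\right\}\right)^2f(\boldsymbol x,\boldsymbol y)\,d\boldsymbol x$$ is bounded uniformly in $\boldsymbol y$. * (A1) $p_{\boldsymbol X,\boldsymbol Z}$ is nice with respect to $\boldsymbol z$, $p_{\boldsymbol X,\boldsymbol Y,\boldsymbol Z}$ is nice with respect to $(\boldsymbol y,\boldsymbol z)$, and $p_{\boldsymbol X,\boldsymbol Y,\boldsymbol Z}$ and all its marginals are uniformly bounded. * (A2) For $(K,d)=(K_1,d_Y+d_Z)$ and $(K,d)=(K_2,d_Z)$: $K$ is bounded, nonnegative,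 symmetric about zero and compactly supported, $\int_{\mathbb R^d}K(\|\boldsymbol u\|)\,d\boldsymbol u=1$, and $\int_{\mathbb R^d}\boldsymbol u^\top\boldsymbol u\,K(\|\boldsymbol u\|)\,d\boldsymbol u=\tau \boldsymbol I_d$ for some $\tau>0$. * (A3) With $d_1=d_Y+d_Z$ and $d_2=d_Z$, as $n\to\infty$: $h_1^{d_1}/h_2^{d_2}\to0$, and $nh_i^{d_i}\to\infty$, $nh_i^{d_i+4}\to0$ for $i=1,2$. **Proposition.** 1. Under $H_0$, for every sample size $n$ and every number of resamples $M$, $\ \mathbb P(p_{CRT}<\alpha)\le\alpha$. (Assumptions (A1)–(A3) are not needed here.) 2. Suppose (A1), (A2) and (A3) hold. Then under $H_1$, for every fixed $M>(1-\alpha)/\alpha$, $\ \lim_{n\to\infty}\mathbb P(p_{CRT}<\alpha)=1$. -/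

import Mathlib

open MeasureTheory ProbabilityTheory Filter Topology
open scoped ENNReal NNReal

noncomputable section

namespace CRT

/-! ### Observations -/

/-- The Euclidean space `ℝ^d` with the Euclidean norm. -/
abbrev E (d : ℕ) := EuclideanSpace ℝ (Fin d)

/-- An observation `(x, y, z)`. -/
abbrev Obs (dX dY dZ : ℕ) := E dX × E dY × E dZ

/-- The Euclidean space `ℝ^dY × ℝ^dZ = ℝ^(dY + dZ)` of pairs `(y, z)`, with the Euclidean norm
(the plain product type would carry the maximum norm). -/
abbrev EYZ (dY dZ : ℕ) := WithLp 2 (E dY × E dZ)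

variable {dX dY dZ : ℕ}

/-- `μ` has the density `p` with respect to Lebesgue measure. -/
structure HasDensity (μ : Measure (Obs dX dY dZ)) (p : Obs dX dY dZ → ℝ) : Prop where
  measurable : Measurable p
  nonneg : ∀ w, 0 ≤ p w
  eq_withDensity : μ = volume.withDensity (fun w => ENNReal.ofReal (p w))

/-- `X` and `Y` are conditionally independent given `Z`, for `(X, Y, Z)` with joint law `μ`. -/
def CondIndep (μ : Measure (Obs dX dY dZ)) [IsProbabilityMeasure μ] : Prop :=
  CondIndepFun (MeasurableSpace.comap (fun w : Obs dX dY dZ => w.2.2) inferInstance)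
    (Measurable.comap_le (by fun_prop))
    (fun w : Obs dX dY dZ => w.1) (fun w : Obs dX dY dZ => w.2.1) μ

/-- `Q` is a regular version of the conditional distribution of `X` given `Z`, for `(X, Y, Z)`
with joint law `μ`. -/
def IsCondLawXZ (μ : Measure (Obs dX dY dZ)) (Q : Kernel (E dZ) (E dX)) : Prop :=
  (μ.map (fun w => (w.2.2, w.1))).IsCondKernel Q

/-! ### The ball divergence and its kernel estimate -/

/-- The ball divergence
`Θ²(P, Q) = ∫∫ (P - Q)²(B̄(u, ρ(v, u))) {dP(u) dP(v) + dQ(u) dQ(v)}`. -/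
def ballDivergence {d : ℕ} (P Q : Measure (E d)) : ℝ :=
  (∫ v, ∫ u, (P.real (Metric.closedBall u (dist v u))
      - Q.real (Metric.closedBall u (dist v u))) ^ 2 ∂P ∂P)
    + ∫ v, ∫ u, (P.real (Metric.closedBall u (dist v u))
      - Q.real (Metric.closedBall u (dist v u))) ^ 2 ∂Q ∂Q

/-- The weighted empirical measure `∑ᵢ (wᵢ / ∑ⱼ wⱼ) δ_{xᵢ}`; it is the zero measure if all the
weights vanish (`0 / 0 = 0`). -/
def weightedEmpirical {d n : ℕ} (w : Fin n → ℝ) (x : Fin n → E d) : Measure (E d) :=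
  ∑ i, ENNReal.ofReal (w i / ∑ j, w j) • Measure.dirac (x i)

/-- The estimate of the law of `X` given `(Y, Z) = (y, z)`, with kernel `K` and bandwidth `h`. -/
def estXgivenYZ {n : ℕ} (K : ℝ → ℝ) (h : ℝ) (D : Fin n → Obs dX dY dZ) (y : E dY) (z : E dZ) :
    Measure (E dX) :=
  weightedEmpirical
    (fun i => K (‖(WithLp.toLp 2 (y, z) - WithLp.toLp 2 (D i).2 : EYZ dY dZ)‖ / h))
    (fun i => (D i).1)

/-- The estimate of the law of `X` given `Z = z`, with kernel `K` and bandwidth `h`. -/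
def estXgivenZ {n : ℕ} (K : ℝ → ℝ) (h : ℝ) (D : Fin n → Obs dX dY dZ) (z : E dZ) :
    Measure (E dX) :=
  weightedEmpirical (fun i => K (‖z - (D i).2.2‖ / h)) (fun i => (D i).1)

/-- The estimated conditional ball divergence `ζ̂_n` of the data set `D`, with weight function `a`.
The kernel profile `K₁` and the bandwidth `h₁` are used on `(y, z)`, and `K₂` and `h₂` on `z`. -/
def zetaHat {n : ℕ} (a : E dY × E dZ → ℝ) (K₁ K₂ : ℝ → ℝ) (h₁ h₂ : ℝ)
    (D : Fin n → Obs dX dY dZ) : ℝ :=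
  (1 / (n : ℝ)) * ∑ s, ballDivergence (estXgivenYZ K₁ h₁ D (D s).2.1 (D s).2.2)
    (estXgivenZ K₂ h₂ D (D s).2.2) * a (D s).2

/-! ### The conditional randomization test -/

/-- The product `x ↦ ⨂ᵢ κᵢ(x)` of finitely many Markov kernels. -/
def piKernel {α β ι : Type*} [MeasurableSpace α] [MeasurableSpace β] [Fintype ι]
    (κ : ι → Kernel α β) [∀ i, IsMarkovKernel (κ i)] : Kernel α (ι → β) where
  toFun x := Measure.pi fun i => κ i x
  measurable' := by
    refine Measurable.measure_of_isPiSystem_of_isProbabilityMeasure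
      generateFrom_pi.symm isPiSystem_pi ?_
    rintro s ⟨t, ht, rfl⟩
    simp only [Set.mem_pi, Set.mem_univ, forall_const, Set.mem_ofPred_eq] at ht
    simp only [Measure.pi_pi]
    exact Finset.measurable_prod _ fun i _ => Kernel.measurable_coe (κ i) (ht i)

instance {α β ι : Type*} [MeasurableSpace α] [MeasurableSpace β] [Fintype ι]
    (κ : ι → Kernel α β) [∀ i, IsMarkovKernel (κ i)] : IsMarkovKernel (piKernel κ) where
  isProbabilityMeasure x := by
    change IsProbabilityMeasure (Measure.pi fun i => κ i x)
    infer_instance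

/-- Given the data `D`, draw `X'_i ∼ Q(Z_i)` independently over `i`. -/
def resample (Q : Kernel (E dZ) (E dX)) [IsMarkovKernel Q] (n : ℕ) :
    Kernel (Fin n → Obs dX dY dZ) (Fin n → E dX) :=
  piKernel fun i => Q.comap (fun D => (D i).2.2) (by fun_prop)

instance (Q : Kernel (E dZ) (E dX)) [IsMarkovKernel Q] (n : ℕ) :
    IsMarkovKernel (resample (dY := dY) Q n) := by
  unfold resample; infer_instance

/-- The joint law of an i.i.d. sample `D₀` of size `n` from `μ` and of `M` resamples of its
`X`-entries, which are conditionally independent given `D₀`. -/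
def crtLaw (μ : Measure (Obs dX dY dZ)) [IsProbabilityMeasure μ]
    (Q : Kernel (E dZ) (E dX)) [IsMarkovKernel Q] (n M : ℕ) :
    Measure ((Fin n → Obs dX dY dZ) × (Fin M → Fin n → E dX)) :=
  (Measure.pi fun _ : Fin n => μ) ⊗ₘ (piKernel fun _ : Fin M => resample Q n)

/-- The resampled data set `{(X'_i, Y_i, Z_i)}`. -/
def replaceX {n : ℕ} (D : Fin n → Obs dX dY dZ) (x' : Fin n → E dX) : Fin n → Obs dX dY dZ :=
  fun i => (x' i, (D i).2)

/-- The `p`-value of the conditional randomization test based on the statistic `T`. -/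
def pCRT {n M : ℕ} (T : (Fin n → Obs dX dY dZ) → ℝ)
    (ω : (Fin n → Obs dX dY dZ) × (Fin M → Fin n → E dX)) : ℝ :=
  (1 + ∑ j : Fin M, if T (replaceX ω.1 (ω.2 j)) ≥ T ω.1 then (1 : ℝ) else 0) / (1 + (M : ℝ))

/-- The probability that the test which rejects when `p_CRT < α`, based on `ζ̂_n` and on `M`
resamples, rejects. -/
def rejectionProb (μ : Measure (Obs dX dY dZ)) [IsProbabilityMeasure μ]
    (Q : Kernel (E dZ) (E dX)) [IsMarkovKernel Q] (a : E dY × E dZ → ℝ) (K₁ K₂ : ℝ → ℝ)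
    (h₁ h₂ : ℝ) (α : ℝ) (n M : ℕ) : ℝ≥0∞ :=
  crtLaw μ Q n M {ω | pCRT (zetaHat a K₁ K₂ h₁ h₂) ω < α}

/-! ### Assumptions -/

/-- A bounded measurable weight function `a ≥ 0`, positive wherever the marginal density of
`(Y, Z)` is positive. -/
structure IsWeight (p : Obs dX dY dZ → ℝ) (a : E dY × E dZ → ℝ) : Prop where
  measurable : Measurable a
  nonneg : ∀ v, 0 ≤ a v
  bounded : ∃ C, ∀ v, a v ≤ C
  pos : ∀ y z, (∫⁻ x, ENNReal.ofReal (p (x, y, z))) ≠ 0 → 0 < a (y, z)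

/-- `δ⁻² { f(x, y + δ u) / f(x, y) - 1 - δ (∂_y f(x, y) / f(x, y)) u }`. -/
def remainder {A B : Type*} [NormedAddCommGroup B] [NormedSpace ℝ B]
    (f : A → B → ℝ) (δ : ℝ) (x : A) (y u : B) : ℝ :=
  1 / δ ^ 2 * (f x (y + δ • u) / f x y - 1 - δ * (fderiv ℝ (f x) y u / f x y))

/-- The density `f(x, y)` is nice with respect to `y`: `∂_y f` exists where it is used (almost
everywhere with respect to `f(x, y) dx`), and for every sequence `δ_n → 0`,
`sup_{‖u‖ = 1} limsup_n ∫ R_n(x, y; u)² f(x, y) dx` is bounded uniformly in `y`. -/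
def Nice {A B : Type*} [MeasureSpace A] [NormedAddCommGroup B] [NormedSpace ℝ B]
    (f : A → B → ℝ) : Prop :=
  (∀ y, ∀ᵐ x, 0 < f x y → DifferentiableAt ℝ (f x) y) ∧
  ∀ δ : ℕ → ℝ, (∀ n, δ n ≠ 0) → Tendsto δ atTop (𝓝 0) →
    ∃ C : ℝ≥0, ∀ y, ⨆ u ∈ Metric.sphere (0 : B) 1,
      limsup (fun n => ∫⁻ x, ENNReal.ofReal (remainder f (δ n) x y u ^ 2 * f x y)) atTop ≤ C

/-- The joint density and all its marginals are uniformly bounded. -/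
def BoundedMarginals (p : Obs dX dY dZ → ℝ) : Prop :=
  ∃ C : ℝ≥0,
    (∀ x y z, ENNReal.ofReal (p (x, y, z)) ≤ C) ∧
    (∀ x y, ∫⁻ z, ENNReal.ofReal (p (x, y, z)) ≤ C) ∧
    (∀ x z, ∫⁻ y, ENNReal.ofReal (p (x, y, z)) ≤ C) ∧
    (∀ y z, ∫⁻ x, ENNReal.ofReal (p (x, y, z)) ≤ C) ∧
    (∀ x, ∫⁻ v : E dY × E dZ, ENNReal.ofReal (p (x, v.1, v.2)) ≤ C) ∧
    (∀ y, ∫⁻ v : E dX × E dZ, ENNReal.ofReal (p (v.1, y, v.2)) ≤ C) ∧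
    (∀ z, ∫⁻ v : E dX × E dY, ENNReal.ofReal (p (v.1, v.2, z)) ≤ C)

/-- The smoothness assumption on the joint density: `p_{X,Z}` is nice with respect to `z`,
`p_{X,Y,Z}` is nice with respect to `(y, z)`, and the densities are bounded. -/
structure DensityAssumption (p : Obs dX dY dZ → ℝ) : Prop where
  nice_z : Nice (fun (x : E dX) (z : E dZ) => ∫ y, p (x, y, z))
  nice_yz : Nice (fun (x : E dX) (v : EYZ dY dZ) => p (x, v.fst, v.snd))
  bounded : BoundedMarginals p

/-- The assumption on the kernel profile `K` in dimension `d`. Only the values of `K` on `[0, ∞)`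
enter the estimates. -/
structure KernelAssumption (d : ℕ) (K : ℝ → ℝ) : Prop where
  bounded : ∃ C, ∀ t, K t ≤ C
  nonneg : ∀ t, 0 ≤ K t
  symm : ∀ t, K (-t) = K t
  compactSupport : HasCompactSupport K
  integral_eq_one : ∫ u : E d, K ‖u‖ = 1
  second_moment : ∃ τ : ℝ, 0 < τ ∧
    ∀ i j : Fin d, ∫ u : E d, u i * u j * K ‖u‖ = if i = j then τ else 0

/-- The assumption on the bandwidth sequences, with `d₁ = dY + dZ` and `d₂ = dZ`. -/
structure BandwidthAssumption (d₁ d₂ : ℕ) (h₁ h₂ : ℕ → ℝ) : Prop where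
  ratio : Tendsto (fun n => h₁ n ^ d₁ / h₂ n ^ d₂) atTop (𝓝 0)
  large₁ : Tendsto (fun n : ℕ => (n : ℝ) * h₁ n ^ d₁) atTop atTop
  large₂ : Tendsto (fun n : ℕ => (n : ℝ) * h₂ n ^ d₂) atTop atTop
  small₁ : Tendsto (fun n : ℕ => (n : ℝ) * h₁ n ^ (d₁ + 4)) atTop (𝓝 0)
  small₂ : Tendsto (fun n : ℕ => (n : ℝ) * h₂ n ^ (d₂ + 4)) atTop (𝓝 0)

end CRT

end

noncomputable section

namespace CRT

variable {dX dY dZ : ℕ}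

/-! Validity. Conditional independence says exactly that redrawing `X` from `Q` given `Z` leaves `μ`
unchanged (`condIndep_iff_resampledLaw_eq`). The observed data may then be regarded as one more
resample of an auxiliary i.i.d. sample. Resampling reads only the `Z`-entries, which it does not
alter, so given the auxiliary sample the observed and the resampled data sets are i.i.d. The rank of
the observed statistic among `M + 1` exchangeable values is controlled by counting
(`card_rank_lt_le`, `pi_rank_lt_le`), and this holds for every measurable statistic.

Power. The statistic converges in probability to the mean of the weighted ball divergence between
the laws of `X` given `(Y, Z)` and given `Z` (`tendsto_zetaHat`). This is applied twice. Under `μ`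
the limit is positive, because ball divergence separates diffuse laws (`integral_zetaLimit_pos`).
Each resampled data set is an i.i.d. sample from `resampledLaw μ Q`, where the two conditional laws
coincide, so its limit is zero. Half the positive limit is a threshold that separates the data from
all `M` resamples with probability tending to one; the `p`-value is then `1 / (1 + M) < α`.

Consistency. No rate is needed, so Lebesgue differentiation gives the limits of the kernel means at
almost every point, and Chebyshev's inequality gives the law of large numbers. Ratios of kernel sums
converge on a countable convergence-determining class, hence the estimated laws converge weakly in
probability. Ball divergence is a polynomial in product measures of the one set `ballSet`, whose
frontier is null when the limit laws do not charge spheres, so it is weakly continuous there.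
Conditional laws inherit absolute continuity from the joint law, which makes spheres null once `0 <
dX`; for `dX = 0` the alternative is empty.

Convergence in probability is encoded by a filter on `Σ n, Ω n`, so that sums, quotients and
continuous maps are handled by the ordinary calculus of `Tendsto`. -/

/-! ### Convergence in probability along a sequence of probability spaces -/

/-- The filter of events whose probability tends to one along a sequence of measure spaces;
`Tendsto f (probFilter P) (𝓝 c)` is convergence in probability. -/
def probFilter {Ω : ℕ → Type*} [∀ n, MeasurableSpace (Ω n)] (P : ∀ n, Measure (Ω n)) :
    Filter (Σ n, Ω n) where
  sets := {S | Tendsto (fun n => P n {ω | (⟨n, ω⟩ : Σ n, Ω n) ∉ S}) atTop (𝓝 0)}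
  univ_sets := by simp
  sets_of_superset {S T} hS hST :=
    tendsto_of_tendsto_of_tendsto_of_le_of_le tendsto_const_nhds hS (fun _ => zero_le)
      (fun n => measure_mono fun ω h h' => h (hST h'))
  inter_sets {S T} hS hT := by
    have h : Tendsto (fun n => P n {ω | (⟨n, ω⟩ : Σ n, Ω n) ∉ S}
        + P n {ω | (⟨n, ω⟩ : Σ n, Ω n) ∉ T}) atTop (𝓝 0) := by
      simpa using Tendsto.add hS hT
    refine tendsto_of_tendsto_of_tendsto_of_le_of_le tendsto_const_nhds h (fun _ => zero_le)
      (fun n => (measure_mono ?_).trans (measure_union_le _ _))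
    intro ω hω
    by_contra hc
    simp only [Set.mem_union, Set.mem_ofPred_eq, not_or, not_not] at hc
    exact hω hc

section ProbFilter

variable {Ω : ℕ → Type*} [∀ n, MeasurableSpace (Ω n)] {P : ∀ n, Measure (Ω n)}

lemma eventually_probFilter {p : (Σ n, Ω n) → Prop} :
    (∀ᶠ x in probFilter P, p x) ↔ Tendsto (fun n => P n {ω | ¬ p ⟨n, ω⟩}) atTop (𝓝 0) :=
  Iff.rfl

/-- This lets deterministic limits in the sample size be composed into limits in probability. -/
lemma tendsto_fst_probFilter : Tendsto Sigma.fst (probFilter P) atTop := by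
  rw [tendsto_atTop]
  intro N
  rw [eventually_probFilter]
  refine tendsto_const_nhds.congr' ?_
  filter_upwards [eventually_ge_atTop N] with n hn
  simp [hn]

/-- Bounded convergence in probability implies convergence of expectations. -/
lemma tendsto_lintegral_of_tendsto_probFilter [∀ n, IsProbabilityMeasure (P n)]
    {f : (Σ n, Ω n) → ℝ≥0∞} {B : ℝ≥0∞} (hB : B ≠ ∞) (hf : ∀ x, f x ≤ B)
    (h : Tendsto f (probFilter P) (𝓝 0)) :
    Tendsto (fun n => ∫⁻ ω, f ⟨n, ω⟩ ∂(P n)) atTop (𝓝 0) := by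
  rw [ENNReal.tendsto_nhds_zero]
  intro ε hε
  have hε2 : 0 < ε / 2 := ENNReal.half_pos hε.ne'
  have h1 := eventually_probFilter.1 (h.eventually (gt_mem_nhds hε2))
  have h2 : Tendsto (fun n => B * P n {ω | ¬ f ⟨n, ω⟩ < ε / 2}) atTop (𝓝 0) := by
    simpa using ENNReal.Tendsto.const_mul h1 (Or.inr hB)
  filter_upwards [ENNReal.tendsto_nhds_zero.1 h2 _ hε2] with n hn
  calc ∫⁻ ω, f ⟨n, ω⟩ ∂(P n)
      ≤ ∫⁻ ω, (ε / 2 + Set.indicator {ω | ¬ f ⟨n, ω⟩ < ε / 2} (fun _ => B) ω) ∂(P n) := by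
        refine lintegral_mono fun ω => ?_
        by_cases hω : f ⟨n, ω⟩ < ε / 2
        · exact hω.le.trans le_self_add
        · rw [Set.indicator_of_mem (by exact hω)]
          exact (hf _).trans le_add_self
    _ ≤ ε / 2 + B * P n {ω | ¬ f ⟨n, ω⟩ < ε / 2} := by
        rw [lintegral_add_left measurable_const]
        refine add_le_add (by simp) (lintegral_indicator_const_le _ _)
    _ ≤ ε / 2 + ε / 2 := by gcongr
    _ = ε := ENNReal.add_halves ε

end ProbFilter

/-- A weak law of large numbers for triangular arrays that are i.i.d. within rows. -/
lemma tendsto_empirical_mean {W : Type*} [MeasurableSpace W] (ν : Measure W)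
    [IsProbabilityMeasure ν] {f : ℕ → W → ℝ} (hf : ∀ n, Measurable (f n)) {B : ℕ → ℝ}
    (h0 : ∀ n w, 0 ≤ f n w) (hB : ∀ n w, f n w ≤ B n) {m : ℝ}
    (hm : Tendsto (fun n => ∫ w, f n w ∂ν) atTop (𝓝 m))
    (hBn : Tendsto (fun n : ℕ => B n / ((n : ℝ) + 1)) atTop (𝓝 0)) :
    Tendsto (fun x : Σ n : ℕ, (Fin (n + 1) → W) =>
        (1 / ((x.1 : ℝ) + 1)) * ∑ i, f x.1 (x.2 i))
      (probFilter fun n => Measure.pi fun _ : Fin (n + 1) => ν) (𝓝 m) := by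
  have hmem : ∀ n p, MemLp (f n) p ν := fun n p =>
    MemLp.of_bound (hf n).aestronglyMeasurable (B n)
      (ae_of_all _ fun w => by rw [Real.norm_of_nonneg (h0 n w)]; exact hB n w)
  have hint : ∀ n, Integrable (f n) ν := fun n => memLp_one_iff_integrable.1 (hmem n 1)
  suffices h : Tendsto (fun x : Σ n : ℕ, (Fin (n + 1) → W) =>
      (1 / ((x.1 : ℝ) + 1)) * ∑ i, f x.1 (x.2 i) - ∫ w, f x.1 w ∂ν)
      (probFilter fun n => Measure.pi fun _ : Fin (n + 1) => ν) (𝓝 0) by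
    simpa using h.add (hm.comp tendsto_fst_probFilter)
  rw [Metric.tendsto_nhds]
  intro ε hε
  rw [eventually_probFilter]
  have hlim : Tendsto (fun n : ℕ => ENNReal.ofReal
      (B n / ((n : ℝ) + 1) * (∫ w, f n w ∂ν) / ε ^ 2)) atTop (𝓝 0) := by
    rw [← ENNReal.ofReal_zero]
    refine ENNReal.tendsto_ofReal ?_
    simpa using (hBn.mul hm).div_const (ε ^ 2)
  refine tendsto_of_tendsto_of_tendsto_of_le_of_le tendsto_const_nhds hlim (fun _ => zero_le) ?_
  intro n
  have hn : (0 : ℝ) < (n : ℝ) + 1 := by positivity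
  set Y : (Fin (n + 1) → W) → ℝ := ∑ i : Fin (n + 1), fun ω => f n (ω i) with hY
  have hYapp : ∀ ω, Y ω = ∑ i, f n (ω i) := fun ω => by simp [hY]
  have hmemi : ∀ i : Fin (n + 1), MemLp (fun ω : Fin (n + 1) → W => f n (ω i)) 2
      (Measure.pi fun _ => ν) := fun i =>
    (hmem n 2).comp_measurePreserving (measurePreserving_eval (fun _ : Fin (n + 1) => ν) i)
  have hYm : MemLp Y 2 (Measure.pi fun _ => ν) := memLp_finsetSum' _ fun i _ => hmemi i
  have hmean : ∫ ω, Y ω ∂(Measure.pi fun _ : Fin (n + 1) => ν)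
      = ((n : ℝ) + 1) * ∫ w, f n w ∂ν := by
    simp_rw [hYapp]
    rw [integral_finsetSum _ fun i _ => (hmemi i).integrable (by norm_num)]
    have : ∀ i : Fin (n + 1), ∫ ω, f n (ω i) ∂(Measure.pi fun _ : Fin (n + 1) => ν)
        = ∫ w, f n w ∂ν := fun i => by
      conv_rhs => rw [← (measurePreserving_eval (fun _ : Fin (n + 1) => ν) i).map_eq]
      rw [integral_map (measurable_pi_apply i).aemeasurable (hf n).aestronglyMeasurable]
    simp [this]
  -- For `0 ≤ f ≤ B` the second moment is at most `B` times the mean. The variance of the average is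
  -- therefore of order `B n / (n + 1)`, so `B n = o(n)` suffices although `B n` may be unbounded.
  have hvar : Var[Y; Measure.pi fun _ : Fin (n + 1) => ν] ≤
      ((n : ℝ) + 1) * (B n * ∫ w, f n w ∂ν) := by
    rw [hY, variance_sum_pi (μ := fun _ : Fin (n + 1) => ν) (X := fun _ => f n)
      (fun _ => hmem n 2)]
    simp only [Finset.sum_const, Finset.card_univ, Fintype.card_fin, nsmul_eq_mul]
    push_cast
    gcongr
    refine (variance_le_expectation_sq (hf n).aestronglyMeasurable).trans ?_
    rw [← integral_const_mul]
    refine integral_mono ((hmem n 2).integrable_sq) ((hint n).const_mul _) fun w => ?_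
    simp only [Pi.pow_apply, sq]
    exact mul_le_mul_of_nonneg_right (hB n w) (h0 n w)
  have hcheb := meas_ge_le_variance_div_sq hYm (c := ((n : ℝ) + 1) * ε) (by positivity)
  refine (measure_mono ?_).trans (hcheb.trans ?_)
  · intro ω hω
    simp only [Real.dist_eq, sub_zero, not_lt, Set.mem_ofPred_eq] at hω ⊢
    rw [hmean, hYapp]
    have : ∑ i, f n (ω i) - ((n : ℝ) + 1) * ∫ w, f n w ∂ν
        = ((n : ℝ) + 1) * (1 / ((n : ℝ) + 1) * ∑ i, f n (ω i) - ∫ w, f n w ∂ν) := by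
      field_simp
    rw [this, abs_mul, abs_of_pos hn]
    gcongr
  · refine ENNReal.ofReal_le_ofReal ?_
    rw [div_le_iff₀ (by positivity)]
    refine hvar.trans (le_of_eq ?_)
    field_simp

/-! ### Kernel averages -/

/-- Measurable, nonnegative and bounded kernel profiles of bounded support. -/
structure IsLocalProfile (K : ℝ → ℝ) : Prop where
  measurable : Measurable K
  nonneg : ∀ t, 0 ≤ K t
  bounded : ∃ C, ∀ t, K t ≤ C
  support : ∃ R, 0 < R ∧ ∀ t, R < t → K t = 0

section Kernel

variable {F : Type*} [NormedAddCommGroup F] [InnerProductSpace ℝ F] [FiniteDimensional ℝ F]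
  [MeasurableSpace F] [BorelSpace F]

lemma IsLocalProfile.integrable {K : ℝ → ℝ} (hK : IsLocalProfile K) :
    Integrable (fun u : F => K ‖u‖) := by
  obtain ⟨C, hC⟩ := hK.bounded
  obtain ⟨R, hR, hKR⟩ := hK.support
  have : IntegrableOn (fun u : F => K ‖u‖) (Metric.closedBall 0 R) := by
    refine Measure.integrableOn_of_bounded (M := C)
      (isCompact_closedBall _ _).measure_lt_top.ne
      (hK.measurable.comp measurable_norm).aestronglyMeasurable (ae_of_all _ fun u => ?_)
    rw [Real.norm_of_nonneg (hK.nonneg _)]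
    exact hC _
  rw [← integrableOn_iff_integrable_of_support_subset (s := Metric.closedBall 0 R)]
  · exact this
  · intro u hu
    by_contra h
    exact hu (hKR _ (by simpa using h))

lemma integral_profile_scaled (K : ℝ → ℝ) {h : ℝ} (hh : 0 < h) (v : F) :
    ∫ v', K (‖v - v'‖ / h) = h ^ Module.finrank ℝ F * ∫ u : F, K ‖u‖ := by
  have h1 : ∫ v', K (‖v - v'‖ / h) = ∫ v' : F, K (‖v'‖ / h) :=
    integral_sub_left_eq_self (fun u : F => K (‖u‖ / h)) volume v
  have h2 := Measure.integral_comp_inv_smul (volume : Measure F) (fun u => K ‖u‖) h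
  rw [h1, abs_of_nonneg (by positivity)] at *
  rw [smul_eq_mul] at h2
  rw [← h2]
  refine integral_congr_ae (ae_of_all _ fun u => ?_)
  simp [norm_smul, abs_of_pos hh, div_eq_inv_mul]

/-- Kernel averages of an integrable function converge almost everywhere. -/
lemma ae_tendsto_kernel_average {K : ℝ → ℝ} (hK : IsLocalProfile K) {f : F → ℝ}
    (hf : Integrable f) :
    ∀ᵐ v, Tendsto (fun h : ℝ => (h ^ Module.finrank ℝ F)⁻¹ * ∫ v', K (‖v - v'‖ / h) * f v')
      (𝓝[>] 0) (𝓝 ((∫ u : F, K ‖u‖) * f v)) := by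
  obtain ⟨C, hC⟩ := hK.bounded
  obtain ⟨R, hR, hKR⟩ := hK.support
  filter_upwards [IsUnifLocDoublingMeasure.ae_tendsto_average_norm_sub
    (μ := (volume : Measure F)) hf.locallyIntegrable 1] with v hv
  have hδ : Tendsto (fun h : ℝ => R * h) (𝓝[>] 0) (𝓝[>] 0) := by
    refine tendsto_nhdsWithin_iff.2 ⟨?_, ?_⟩
    · have : Tendsto (fun h : ℝ => R * h) (𝓝 0) (𝓝 (R * 0)) :=
        (continuous_const_mul R).tendsto 0
      rw [mul_zero] at this
      exact this.mono_left nhdsWithin_le_nhds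
    · filter_upwards [self_mem_nhdsWithin] with h hh
      exact mul_pos hR hh
  have hav := hv (fun _ : ℝ => v) (fun h : ℝ => R * h) hδ (by
    filter_upwards [self_mem_nhdsWithin] with h hh
    have hh' : 0 < h := hh
    simp; positivity)
  rw [tendsto_iff_norm_sub_tendsto_zero]
  -- At a Lebesgue point, a kernel bounded by `C` and vanishing beyond `R` is dominated by a
  -- constant times the average over the ball of radius `R * h`.
  have hlim : Tendsto (fun h : ℝ => C * volume.real (Metric.closedBall (0 : F) R) *
      ⨍ y in Metric.closedBall v (R * h), ‖f y - f v‖) (𝓝[>] 0) (𝓝 0) := by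
    simpa using hav.const_mul (C * volume.real (Metric.closedBall (0 : F) R))
  refine tendsto_of_tendsto_of_tendsto_of_le_of_le' tendsto_const_nhds hlim
    (Eventually.of_forall fun _ => norm_nonneg _) ?_
  filter_upwards [self_mem_nhdsWithin] with h hh
  have hh : 0 < h := hh
  have hhd : 0 < h ^ Module.finrank ℝ F := by positivity
  have hKm : Measurable fun v' : F => K (‖v - v'‖ / h) := hK.measurable.comp (by fun_prop)
  have hKb : ∀ v' : F, ‖K (‖v - v'‖ / h)‖ ≤ C := fun v' => by
    rw [Real.norm_of_nonneg (hK.nonneg _)]; exact hC _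
  have hKf : Integrable fun v' : F => K (‖v - v'‖ / h) * f v' :=
    hf.bdd_mul hKm.aestronglyMeasurable (ae_of_all _ hKb)
  have hKi : Integrable fun v' : F => K (‖v - v'‖ / h) := by
    have h1 : Integrable fun u : F => K (‖u‖ / h) := by
      have := (hK.integrable (F := F)).comp_smul (inv_ne_zero hh.ne')
      refine this.congr (ae_of_all _ fun u => ?_)
      simp [norm_smul, abs_of_pos hh, div_eq_inv_mul]
    exact h1.comp_sub_left v
  have heq : ((h ^ Module.finrank ℝ F)⁻¹ * ∫ v', K (‖v - v'‖ / h) * f v')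
      - (∫ u : F, K ‖u‖) * f v
      = (h ^ Module.finrank ℝ F)⁻¹ * ∫ v', K (‖v - v'‖ / h) * (f v' - f v) := by
    simp_rw [mul_sub]
    rw [integral_sub hKf (hKi.mul_const _), integral_mul_const, integral_profile_scaled K hh]
    field_simp
  rw [heq, norm_mul, norm_inv, Real.norm_of_nonneg hhd.le]
  have hvol : volume.real (Metric.closedBall v (R * h))
      = h ^ Module.finrank ℝ F * volume.real (Metric.closedBall (0 : F) R) := by
    rw [mul_comm R h, Measure.real, Measure.addHaar_closedBall_mul _ _ hh.le hR.le,
      ENNReal.toReal_mul, ENNReal.toReal_ofReal hhd.le, ← Measure.addHaar_closedBall_center _ (0:F)]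
    rfl
  have hvpos : 0 < volume.real (Metric.closedBall (0 : F) R) :=
    ENNReal.toReal_pos (Metric.measure_closedBall_pos _ _ hR).ne'
      (isCompact_closedBall _ _).measure_lt_top.ne
  have hfi : IntegrableOn (fun y => ‖f y - f v‖) (Metric.closedBall v (R * h)) :=
    (hf.integrableOn.sub (integrableOn_const
      (isCompact_closedBall _ _).measure_lt_top.ne)).norm
  have hbd : ‖∫ v', K (‖v - v'‖ / h) * (f v' - f v)‖
      ≤ C * ∫ y in Metric.closedBall v (R * h), ‖f y - f v‖ := by
    rw [← integral_const_mul]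
    have h1 : ∫ v', K (‖v - v'‖ / h) * (f v' - f v)
        = ∫ v' in Metric.closedBall v (R * h), K (‖v - v'‖ / h) * (f v' - f v) := by
      rw [setIntegral_eq_integral_of_forall_compl_eq_zero]
      intro y hy
      rw [hKR, zero_mul]
      rw [lt_div_iff₀ hh]
      simpa [dist_eq_norm, norm_sub_rev] using hy
    rw [h1]
    refine norm_integral_le_of_norm_le (hfi.const_mul C) (ae_of_all _ fun y => ?_)
    rw [norm_mul]
    exact mul_le_mul_of_nonneg_right (hKb y) (norm_nonneg _)
  rw [setAverage_eq, hvol, smul_eq_mul]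
  calc _ ≤ (h ^ Module.finrank ℝ F)⁻¹ * (C * ∫ y in Metric.closedBall v (R * h), ‖f y - f v‖) := by
        gcongr
    _ = _ := by field_simp

end Kernel

/-! ### Consistency of kernel estimates of conditional laws -/

section Estimator

variable {W F : Type*} [MeasurableSpace W] [NormedAddCommGroup F] [InnerProductSpace ℝ F]
  [FiniteDimensional ℝ F] [MeasurableSpace F] [BorelSpace F]

/-- This identifies the numerator of the estimator: if `V` has density `q`, the observations with `X
∈ A` have density `q v * κ v A` at `v`, and dividing by `q v` leaves the conditional probability. -/
lemma map_restrict_preimage_of_disintegration {W F 𝒳 : Type*} [MeasurableSpace W]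
    [MeasurableSpace F] [MeasurableSpace 𝒳] {ν : Measure W} [IsFiniteMeasure ν] {V : W → F}
    (hV : Measurable V) {X : W → 𝒳} (hX : Measurable X) {κ : Kernel F 𝒳} [IsMarkovKernel κ]
    (hκ : ν.map (fun w => (V w, X w)) = ν.map V ⊗ₘ κ) {A : Set 𝒳} (hA : MeasurableSet A) :
    (ν.restrict (X ⁻¹' A)).map V = (ν.map V).withDensity (fun v => κ v A) := by
  ext B hB
  rw [Measure.map_apply hV hB, Measure.restrict_apply (hV hB), withDensity_apply _ hB]
  have h : ν.map (fun w => (V w, X w)) (B ×ˢ A) = (ν.map V ⊗ₘ κ) (B ×ˢ A) := by rw [hκ]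
  rw [Measure.map_apply (hV.prodMk hX) (hB.prod hA), Measure.compProd_apply_prod hB hA] at h
  exact h

/-- The kernel sums over the observations with `X ∈ A` converge in probability, also after
one observation of the sample is replaced by a fixed one. -/
lemma ae_tendsto_kernel_sum (ν : Measure W) [IsProbabilityMeasure ν] {V : W → F}
    (hV : Measurable V) (hac : ν.map V ≪ volume) {K : ℝ → ℝ} (hK : IsLocalProfile K)
    {h : ℕ → ℝ} (hh : ∀ n, 0 < h n) (h0 : Tendsto h atTop (𝓝 0))
    (hlarge : Tendsto (fun n : ℕ => ((n : ℝ) + 1) * h n ^ Module.finrank ℝ F) atTop atTop)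
    {A : Set W} (hA : MeasurableSet A) :
    ∀ᵐ v : F, ∀ (s : ∀ n : ℕ, Fin (n + 1)) (w : W),
      Tendsto (fun x : Σ n : ℕ, (Fin (n + 1) → W) => (1 / ((x.1 : ℝ) + 1)) *
          ∑ i, (h x.1 ^ Module.finrank ℝ F)⁻¹ *
            (K (‖v - V (Function.update x.2 (s x.1) w i)‖ / h x.1)
              * A.indicator 1 (Function.update x.2 (s x.1) w i)))
        (probFilter fun n => Measure.pi fun _ : Fin (n + 1) => ν)
        (𝓝 ((∫ u : F, K ‖u‖) * (((ν.restrict A).map V).rnDeriv volume v).toReal)) := by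
  obtain ⟨C, hC⟩ := hK.bounded
  have hC0 : 0 ≤ C := (hK.nonneg 0).trans (hC 0)
  have hacA : (ν.restrict A).map V ≪ (volume : Measure F) :=
    (Measure.restrict_le_self.absolutelyContinuous.map hV).trans hac
  have hhd : ∀ n, 0 < h n ^ Module.finrank ℝ F := fun n => pow_pos (hh n) _
  have hI0 : ∀ w, (0 : ℝ) ≤ A.indicator 1 w := fun w =>
    Set.indicator_nonneg (fun _ _ => zero_le_one) w
  have hI1 : ∀ w, A.indicator (1 : W → ℝ) w ≤ 1 := fun w =>
    Set.indicator_le_self' (fun _ _ => zero_le_one) w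
  -- The null set is chosen before `s` and `w`; this matters because `w` will later be the very
  -- observation at which the estimate is evaluated.
  filter_upwards [ae_tendsto_kernel_average hK
    (Measure.integrable_toReal_rnDeriv (μ := (ν.restrict A).map V) (ν := volume))] with v hv s w
  set g : ℕ → W → ℝ := fun n w => (h n ^ Module.finrank ℝ F)⁻¹ *
            (K (‖v - V w‖ / h n) * A.indicator 1 w) with hg
  have hKm : ∀ n, Measurable fun v' : F => K (‖v - v'‖ / h n) := fun n =>
    hK.measurable.comp (by fun_prop)
  have hgm : ∀ n, Measurable (g n) := fun n =>
    (((hKm n).comp hV).mul (measurable_one.indicator hA)).const_mul _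
  have hg0 : ∀ n w, 0 ≤ g n w := fun n w =>
    mul_nonneg (inv_nonneg.2 (hhd n).le) (mul_nonneg (hK.nonneg _) (hI0 w))
  have hgB : ∀ n w, g n w ≤ C / h n ^ Module.finrank ℝ F := fun n w => by
    rw [div_eq_inv_mul]
    refine mul_le_mul_of_nonneg_left ?_ (inv_nonneg.2 (hhd n).le)
    calc _ ≤ C * 1 := mul_le_mul (hC _) (hI1 w) (hI0 w) hC0
      _ = C := mul_one C
  have hmean : ∀ n, ∫ w, g n w ∂ν = (h n ^ Module.finrank ℝ F)⁻¹ *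
      ∫ v', K (‖v - v'‖ / h n) * (((ν.restrict A).map V).rnDeriv volume v').toReal := fun n => by
    simp only [hg]
    rw [integral_const_mul]
    congr 1
    have h1 : ∀ w, K (‖v - V w‖ / h n) * A.indicator 1 w
        = A.indicator (fun w => K (‖v - V w‖ / h n)) w := fun w => by
      by_cases hw : w ∈ A <;> simp [hw]
    simp_rw [h1]
    rw [integral_indicator hA, ← integral_map (f := fun v' => K (‖v - v'‖ / h n)) hV.aemeasurable
      (hKm n).aestronglyMeasurable, ← integral_rnDeriv_smul hacA]
    exact integral_congr_ae (ae_of_all _ fun _ => mul_comm _ _)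
  have hh0 : Tendsto h atTop (𝓝[>] 0) :=
    tendsto_nhdsWithin_iff.2 ⟨h0, Eventually.of_forall hh⟩
  have hsmall : Tendsto (fun n : ℕ => C / h n ^ Module.finrank ℝ F / ((n : ℝ) + 1)) atTop
      (𝓝 0) := by
    have := hlarge.const_div_atTop C
    refine this.congr fun n => ?_
    rw [div_div, mul_comm]
  have hmain := tendsto_empirical_mean ν hgm hg0 hgB
    (m := (∫ u : F, K ‖u‖) * (((ν.restrict A).map V).rnDeriv volume v).toReal)
    ((hv.comp hh0).congr fun n => (hmean n).symm) hsmall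
  -- Replacing one entry exchanges two values in `[0, C / h ^ d]`, with `d` the dimension of `F`, so
  -- it moves the mean by at most `C / (h ^ d * (n + 1))`, which tends to zero.
  have hdiff : Tendsto (fun x : Σ n : ℕ, (Fin (n + 1) → W) =>
      (1 / ((x.1 : ℝ) + 1)) * ∑ i, g x.1 (Function.update x.2 (s x.1) w i)
        - (1 / ((x.1 : ℝ) + 1)) * ∑ i, g x.1 (x.2 i))
      (probFilter fun n => Measure.pi fun _ : Fin (n + 1) => ν) (𝓝 0) := by
    refine squeeze_zero_norm (fun x => ?_) (hsmall.comp tendsto_fst_probFilter)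
    have hn : (0 : ℝ) < (x.1 : ℝ) + 1 := by positivity
    have h1 : ∑ i, g x.1 (Function.update x.2 (s x.1) w i) - ∑ i, g x.1 (x.2 i)
        = g x.1 w - g x.1 (x.2 (s x.1)) := by
      rw [← Finset.sum_sub_distrib, Finset.sum_eq_single (s x.1)]
      · simp
      · intro i _ hi
        simp [Function.update_of_ne hi]
      · simp
    rw [← mul_sub, h1, norm_mul, Real.norm_of_nonneg (by positivity), Function.comp_apply,
      one_div, div_eq_inv_mul (C / _)]
    refine mul_le_mul_of_nonneg_left ?_ (by positivity)
    rw [Real.norm_eq_abs, abs_le]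
    constructor <;> linarith [hg0 x.1 w, hg0 x.1 (x.2 (s x.1)), hgB x.1 w,
      hgB x.1 (x.2 (s x.1))]
  simpa using hdiff.add hmain

lemma weightedEmpirical_real {d n : ℕ} {w : Fin n → ℝ} (hw : ∀ i, 0 ≤ w i) (x : Fin n → E d)
    {A : Set (E d)} (hA : MeasurableSet A) :
    (weightedEmpirical w x).real A = (∑ i, w i * A.indicator 1 (x i)) / ∑ i, w i := by
  have h0 : ∀ i, 0 ≤ w i / ∑ j, w j := fun i =>
    div_nonneg (hw i) (Finset.sum_nonneg fun j _ => hw j)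
  rw [weightedEmpirical, Measure.real, Measure.finsetSum_apply, ENNReal.toReal_sum, Finset.sum_div]
  · refine Finset.sum_congr rfl fun i _ => ?_
    rw [Measure.smul_apply, smul_eq_mul, ENNReal.toReal_mul, ENNReal.toReal_ofReal (h0 i),
      Measure.dirac_apply' _ hA]
    by_cases hi : x i ∈ A <;> simp [hi]
  · intro i _
    rw [Measure.smul_apply, smul_eq_mul]
    exact ENNReal.mul_ne_top ENNReal.ofReal_ne_top (measure_ne_top _ _)

instance {d n : ℕ} (w : Fin n → ℝ) (x : Fin n → E d) : IsFiniteMeasure (weightedEmpirical w x) := by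
  refine ⟨?_⟩
  rw [weightedEmpirical, Measure.finsetSum_apply]
  refine ENNReal.sum_lt_top.2 fun i _ => ?_
  rw [Measure.smul_apply, smul_eq_mul]
  exact ENNReal.mul_lt_top ENNReal.ofReal_lt_top (measure_lt_top _ _)

lemma isProbabilityMeasure_weightedEmpirical {d n : ℕ} {w : Fin n → ℝ} (hw : ∀ i, 0 ≤ w i)
    (x : Fin n → E d) (h : 0 < ∑ i, w i) : IsProbabilityMeasure (weightedEmpirical w x) := by
  refine ⟨?_⟩
  have := weightedEmpirical_real hw x MeasurableSet.univ
  simp only [Set.indicator_univ, Pi.one_apply, mul_one, div_self h.ne'] at this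
  rw [Measure.real] at this
  rw [← ENNReal.toReal_eq_one_iff, this]

open Classical in
/-- A measure as a probability measure, with a default value for other measures. -/
def toProb {d : ℕ} (P : Measure (E d)) : ProbabilityMeasure (E d) :=
  if h : IsProbabilityMeasure P then ⟨P, h⟩ else ⟨Measure.dirac 0, inferInstance⟩

lemma toProb_apply {d : ℕ} (P : Measure (E d)) [h : IsProbabilityMeasure P] (A : Set (E d)) :
    ((toProb P A : ℝ≥0) : ℝ) = P.real A := by
  have h' : toProb P = ⟨P, h⟩ := dif_pos h
  rw [h']; rfl

lemma toProb_coe {d : ℕ} (P : Measure (E d)) [h : IsProbabilityMeasure P] :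
    (toProb P : Measure (E d)) = P := by
  have h' : toProb P = ⟨P, h⟩ := dif_pos h
  rw [h']; rfl

/-- There is a countable family of measurable sets such that convergence on it, along any filter,
implies weak convergence of probability measures. -/
lemma exists_countable_convergence_determining (Ω : Type*) [TopologicalSpace Ω]
    [SecondCountableTopology Ω] [MeasurableSpace Ω] [OpensMeasurableSpace Ω] :
    ∃ S : Set (Set Ω), S.Countable ∧ (∀ s ∈ S, MeasurableSet s) ∧
      ∀ {ι : Type*} (l : Filter ι) (P : ι → ProbabilityMeasure Ω) (P₀ : ProbabilityMeasure Ω),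
        (∀ s ∈ S, Tendsto (fun i => P i s) l (𝓝 (P₀ s))) → Tendsto P l (𝓝 P₀) := by
  have hb := TopologicalSpace.isBasis_countableBasis Ω
  have hbc := TopologicalSpace.countable_countableBasis Ω
  -- Finite intersections of basic open sets: still countable, and now closed under intersection.
  let S : Set (Set Ω) := (fun t : Set (Set Ω) => ⋂₀ t) ''
    {t | t.Finite ∧ t ⊆ TopologicalSpace.countableBasis Ω}
  have hSc : S.Countable := (Set.countable_ofPred_finite_subset hbc).image _
  have hSo : ∀ s ∈ S, IsOpen s := by
    rintro _ ⟨t, ⟨htf, ht⟩, rfl⟩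
    exact htf.isOpen_sInter fun u hu => hb.isOpen (ht hu)
  have hSpi : IsPiSystem S := by
    rintro _ ⟨t, ⟨htf, ht⟩, rfl⟩ _ ⟨t', ⟨htf', ht'⟩, rfl⟩ _
    exact ⟨t ∪ t', ⟨htf.union htf', Set.union_subset ht ht'⟩, Set.sInter_union t t'⟩
  have hSn : ∀ u : Set Ω, IsOpen u → ∀ x ∈ u, ∃ s ∈ S, s ∈ 𝓝 x ∧ s ⊆ u := by
    intro u hu x hx
    obtain ⟨v, hv, hxv, hvu⟩ := hb.exists_subset_of_mem_open hx hu
    exact ⟨v, ⟨{v}, ⟨Set.finite_singleton v, by simpa using hv⟩, by simp⟩,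
      (hb.isOpen hv).mem_nhds hxv, hvu⟩
  refine ⟨S, hSc, fun s hs => (hSo s hs).measurableSet, fun {ι} l P P₀ h => ?_⟩
  have : Countable S := hSc
  -- As `S` is countable, `l'` is countably generated, so the π-system criterion applies to it. An
  -- arbitrary filter `l` is then handled by mapping it into `l'`.
  let l' : Filter (ProbabilityMeasure Ω) := ⨅ s : S, comap (fun P => P s) (𝓝 (P₀ s))
  have hl' : Tendsto id l' (𝓝 P₀) :=
    hSpi.tendsto_probabilityMeasure_of_tendsto_of_mem
      (fun s hs => (hSo s hs).measurableSet) hSn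
      (fun s hs => tendsto_comap.mono_left (iInf_le _ (⟨s, hs⟩ : S)))
  refine hl'.comp (tendsto_iInf.2 fun s => tendsto_comap_iff.2 (h s s.2))

/-- Kernel estimates of a conditional law converge weakly in probability, at almost every point. -/
lemma ae_tendsto_kernel_estimate {d : ℕ} (ν : Measure W) [IsProbabilityMeasure ν] {V : W → F}
    (hV : Measurable V) (hac : ν.map V ≪ volume) {X : W → E d} (hX : Measurable X)
    {κ : Kernel F (E d)} [IsMarkovKernel κ]
    (hκ : ν.map (fun w => (V w, X w)) = ν.map V ⊗ₘ κ)
    {K : ℝ → ℝ} (hK : IsLocalProfile K) (hKpos : 0 < ∫ u : F, K ‖u‖)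
    {h : ℕ → ℝ} (hh : ∀ n, 0 < h n) (h0 : Tendsto h atTop (𝓝 0))
    (hlarge : Tendsto (fun n : ℕ => ((n : ℝ) + 1) * h n ^ Module.finrank ℝ F) atTop atTop) :
    ∀ᵐ w₀ ∂ν, ∀ (s : ∀ n : ℕ, Fin (n + 1)) (w : W),
      (∀ᶠ x : Σ n : ℕ, (Fin (n + 1) → W) in
          probFilter fun n => Measure.pi fun _ : Fin (n + 1) => ν,
        IsProbabilityMeasure (weightedEmpirical
          (fun i => K (‖V w₀ - V (Function.update x.2 (s x.1) w i)‖ / h x.1))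
          (fun i => X (Function.update x.2 (s x.1) w i)))) ∧
      Tendsto (fun x : Σ n : ℕ, (Fin (n + 1) → W) => toProb (weightedEmpirical
          (fun i => K (‖V w₀ - V (Function.update x.2 (s x.1) w i)‖ / h x.1))
          (fun i => X (Function.update x.2 (s x.1) w i))))
        (probFilter fun n => Measure.pi fun _ : Fin (n + 1) => ν)
        (𝓝 (toProb (κ (V w₀)))) := by
  obtain ⟨S, hSc, hSm, hS⟩ := exists_countable_convergence_determining (E d)
  set q : F → ℝ≥0∞ := (ν.map V).rnDeriv volume with hq
  have hqd : (volume : Measure F).withDensity q = ν.map V := Measure.withDensity_rnDeriv_eq _ _ hac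
  have hqm : Measurable q := Measure.measurable_rnDeriv _ _
  have hdens : ∀ A : Set (E d), MeasurableSet A →
      ((ν.restrict (X ⁻¹' A)).map V).rnDeriv volume =ᵐ[volume] fun v => q v * κ v A := by
    intro A hA
    rw [map_restrict_preimage_of_disintegration hV hX hκ hA, ← hqd,
      ← withDensity_mul _ hqm (Kernel.measurable_coe κ hA)]
    exact Measure.rnDeriv_withDensity _ (hqm.mul (Kernel.measurable_coe κ hA))
  have hVae : ∀ {p : F → Prop}, (∀ᵐ v : F, p v) → ∀ᵐ w ∂ν, p (V w) := fun hp =>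
    ae_of_ae_map hV.aemeasurable (hac.ae_le hp)
  -- An observation almost surely falls where its own density is positive, so the denominator of the
  -- estimate has a positive limit.
  have hqpos : ∀ᵐ w ∂ν, q (V w) ≠ 0 := by
    refine ae_of_ae_map (p := fun v => q v ≠ 0) hV.aemeasurable ?_
    rw [← hqd]
    exact (ae_withDensity_iff hqm).2 (ae_of_all _ fun _ h => h)
  have hqtop : ∀ᵐ w ∂ν, q (V w) < ∞ := hVae (Measure.rnDeriv_lt_top _ _)
  have hall := hVae (ae_tendsto_kernel_sum ν hV hac hK hh h0 hlarge MeasurableSet.univ)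
  have hallA := hVae ((ae_ball_iff hSc).2 fun A hA =>
    ae_tendsto_kernel_sum ν hV hac hK hh h0 hlarge (hX (hSm A hA)))
  have hdA := hVae ((ae_ball_iff hSc).2 fun A hA => hdens A (hSm A hA))
  filter_upwards [hall, hallA, hdA, hqpos, hqtop] with w₀ h1 hA hdA hq0 hq1 s w
  set D : (x : Σ n : ℕ, (Fin (n + 1) → W)) → Fin (x.1 + 1) → W :=
    fun x => Function.update x.2 (s x.1) w with hD
  have hqr : 0 < (q (V w₀)).toReal := ENNReal.toReal_pos hq0 hq1.ne
  have hK0 : ∀ (x : Σ n : ℕ, (Fin (n + 1) → W)) i, 0 ≤ K (‖V w₀ - V (D x i)‖ / h x.1) :=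
    fun x i => hK.nonneg _
  have hfac : ∀ (x : Σ n : ℕ, (Fin (n + 1) → W)),
      (1 / ((x.1 : ℝ) + 1)) * (h x.1 ^ Module.finrank ℝ F)⁻¹ ≠ 0 := fun x => by
    have := hh x.1
    positivity
  have hfacpos : ∀ (x : Σ n : ℕ, (Fin (n + 1) → W)),
      0 < (1 / ((x.1 : ℝ) + 1)) * (h x.1 ^ Module.finrank ℝ F)⁻¹ := fun x => by
    have := hh x.1
    positivity
  have h1' := h1 s w
  simp only [Set.indicator_univ, Pi.one_apply, mul_one, Measure.restrict_univ,
    ← Finset.mul_sum, ← mul_assoc] at h1'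
  have hev : ∀ᶠ x : Σ n : ℕ, (Fin (n + 1) → W) in
      probFilter fun n => Measure.pi fun _ : Fin (n + 1) => ν,
      0 < ∑ i, K (‖V w₀ - V (D x i)‖ / h x.1) := by
    filter_upwards [h1'.eventually (lt_mem_nhds (mul_pos hKpos hqr))] with x hx
    exact pos_of_mul_pos_right hx (hfacpos x).le
  have hev' : ∀ᶠ x : Σ n : ℕ, (Fin (n + 1) → W) in
          probFilter fun n => Measure.pi fun _ : Fin (n + 1) => ν,
        IsProbabilityMeasure (weightedEmpirical
          (fun i => K (‖V w₀ - V (D x i)‖ / h x.1)) (fun i => X (D x i))) := by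
    filter_upwards [hev] with x hx
    exact isProbabilityMeasure_weightedEmpirical (hK0 x) _ hx
  refine ⟨hev', hS _ _ _ fun A hAS => ?_⟩
  have hA' := hA A hAS s w
  simp only [← Finset.mul_sum] at hA'
  simp only [← mul_assoc (1 / _ : ℝ)] at hA'
  rw [hdA A hAS] at hA'
  -- The normalising factor `1 / (n + 1) * (h ^ d)⁻¹` is common to numerator and denominator and
  -- cancels, as does the integral of the kernel.
  have hdiv := hA'.div h1' (mul_pos hKpos hqr).ne'
  have hlim : (∫ u : F, K ‖u‖) * (q (V w₀) * κ (V w₀) A).toReal /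
      ((∫ u : F, K ‖u‖) * (q (V w₀)).toReal) = (κ (V w₀)).real A := by
    rw [ENNReal.toReal_mul, Measure.real]
    field_simp
  rw [hlim] at hdiv
  rw [← NNReal.tendsto_coe, toProb_apply]
  refine hdiv.congr' ?_
  filter_upwards [hev'] with x hx
  rw [toProb_apply, weightedEmpirical_real (hK0 x) _ (hSm A hAS), Pi.div_apply,
    mul_div_mul_left _ _ (hfac x)]
  rfl

end Estimator

/-! ### The ball divergence -/

section BallDivergence

variable {d : ℕ}

/-- The quadruples `((v, u), (x, x'))` with `x` and `x'` in the closed ball of center `u`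
through `v`. -/
def ballSet (d : ℕ) : Set ((E d × E d) × (E d × E d)) :=
  {q | dist q.2.1 q.1.2 ≤ dist q.1.1 q.1.2} ∩ {q | dist q.2.2 q.1.2 ≤ dist q.1.1 q.1.2}

/-- The integral `∫∫ R₁(B̄(u, ρ(v, u))) R₂(B̄(u, ρ(v, u))) dP(u) dP(v)`. -/
def ballQuad (P R₁ R₂ : Measure (E d)) : ℝ :=
  (((P.prod P).prod (R₁.prod R₂)) (ballSet d)).toReal

lemma measurableSet_ballSet : MeasurableSet (ballSet d) :=
  (measurableSet_le (by fun_prop) (by fun_prop)).inter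
    (measurableSet_le (by fun_prop) (by fun_prop))

lemma prodMk_preimage_ballSet (v u : E d) :
    Prod.mk (v, u) ⁻¹' ballSet d
      = Metric.closedBall u (dist v u) ×ˢ Metric.closedBall u (dist v u) := rfl

lemma measurable_ball_mul_ball (R₁ R₂ : Measure (E d)) [IsFiniteMeasure R₁] [IsFiniteMeasure R₂] :
    Measurable fun q : E d × E d => R₁.real (Metric.closedBall q.2 (dist q.1 q.2))
      * R₂.real (Metric.closedBall q.2 (dist q.1 q.2)) := by
  have h := (measurable_measure_prodMk_left (ν := R₁.prod R₂)
    (measurableSet_ballSet (d := d))).ennreal_toReal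
  convert! h using 1
  ext ⟨v, u⟩
  simp [prodMk_preimage_ballSet, Measure.real]

lemma integrable_ball_mul_ball (P R₁ R₂ : Measure (E d)) [IsFiniteMeasure P] [IsFiniteMeasure R₁]
    [IsFiniteMeasure R₂] :
    Integrable (fun q : E d × E d => R₁.real (Metric.closedBall q.2 (dist q.1 q.2))
      * R₂.real (Metric.closedBall q.2 (dist q.1 q.2))) (P.prod P) := by
  refine Integrable.of_bound (measurable_ball_mul_ball R₁ R₂).aestronglyMeasurable
    (R₁.real Set.univ * R₂.real Set.univ) (ae_of_all _ fun q => ?_)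
  rw [Real.norm_of_nonneg (by positivity)]
  exact mul_le_mul (measureReal_mono (Set.subset_univ _)) (measureReal_mono (Set.subset_univ _))
    measureReal_nonneg measureReal_nonneg

lemma integral_ball_mul_ball (P R₁ R₂ : Measure (E d)) [IsFiniteMeasure P] [IsFiniteMeasure R₁]
    [IsFiniteMeasure R₂] :
    ∫ q, R₁.real (Metric.closedBall q.2 (dist q.1 q.2))
      * R₂.real (Metric.closedBall q.2 (dist q.1 q.2)) ∂(P.prod P) = ballQuad P R₁ R₂ := by
  rw [ballQuad, Measure.prod_apply measurableSet_ballSet,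
    ← integral_toReal (measurable_measure_prodMk_left measurableSet_ballSet).aemeasurable
      (ae_of_all _ fun _ => measure_lt_top _ _)]
  refine integral_congr_ae (ae_of_all _ fun q => ?_)
  obtain ⟨v, u⟩ := q
  simp [prodMk_preimage_ballSet, Measure.real]

lemma integrable_ball_sub_sq (S P Q : Measure (E d)) [IsFiniteMeasure S] [IsFiniteMeasure P]
    [IsFiniteMeasure Q] :
    Integrable (fun q : E d × E d => (P.real (Metric.closedBall q.2 (dist q.1 q.2))
      - Q.real (Metric.closedBall q.2 (dist q.1 q.2))) ^ 2) (S.prod S) := by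
  have h := ((integrable_ball_mul_ball S P P).sub
    ((integrable_ball_mul_ball S P Q).const_mul 2)).add (integrable_ball_mul_ball S Q Q)
  refine h.congr (ae_of_all _ fun q => ?_)
  simp only [Pi.add_apply, Pi.sub_apply]
  ring

lemma integral_ball_sub_sq (S P Q : Measure (E d)) [IsFiniteMeasure S] [IsFiniteMeasure P]
    [IsFiniteMeasure Q] :
    ∫ v, ∫ u, (P.real (Metric.closedBall u (dist v u))
      - Q.real (Metric.closedBall u (dist v u))) ^ 2 ∂S ∂S
      = ballQuad S P P - 2 * ballQuad S P Q + ballQuad S Q Q := by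
  have h1 := integrable_ball_mul_ball S P P
  have h2 := (integrable_ball_mul_ball S P Q).const_mul 2
  have h3 := integrable_ball_mul_ball S Q Q
  rw [← integral_prod _ (integrable_ball_sub_sq S P Q), ← integral_ball_mul_ball,
    ← integral_ball_mul_ball, ← integral_ball_mul_ball, ← integral_const_mul,
    ← integral_sub h1 h2]
  refine Eq.trans ?_ (integral_add (h1.sub h2) h3)
  refine integral_congr_ae (ae_of_all _ fun q => ?_)
  dsimp only
  ring

/-- Expanding the square leaves only product measures of the fixed set `ballSet`. Measurability in
kernel parameters and weak continuity both follow from this form. -/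
lemma ballDivergence_eq (P Q : Measure (E d)) [IsFiniteMeasure P] [IsFiniteMeasure Q] :
    ballDivergence P Q = (ballQuad P P P - 2 * ballQuad P P Q + ballQuad P Q Q)
      + (ballQuad Q P P - 2 * ballQuad Q P Q + ballQuad Q Q Q) := by
  rw [ballDivergence, integral_ball_sub_sq, integral_ball_sub_sq]

lemma ballDivergence_nonneg (P Q : Measure (E d)) : 0 ≤ ballDivergence P Q :=
  add_nonneg (integral_nonneg fun _ => integral_nonneg fun _ => sq_nonneg _)
    (integral_nonneg fun _ => integral_nonneg fun _ => sq_nonneg _)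

lemma ballDivergence_le_two {P Q : Measure (E d)} [IsFiniteMeasure P] [IsFiniteMeasure Q]
    (hP : P.real Set.univ ≤ 1) (hQ : Q.real Set.univ ≤ 1) : ballDivergence P Q ≤ 2 := by
  have key : ∀ S : Measure (E d), IsFiniteMeasure S → S.real Set.univ ≤ 1 →
      ∫ v, ∫ u, (P.real (Metric.closedBall u (dist v u))
        - Q.real (Metric.closedBall u (dist v u))) ^ 2 ∂S ∂S ≤ 1 := by
    intro S _ hS
    have hb : ∀ B : Set (E d), ‖(P.real B - Q.real B) ^ 2‖ ≤ 1 := fun B => by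
      have h1 : P.real B ≤ 1 := (measureReal_mono (Set.subset_univ _)).trans hP
      have h2 : Q.real B ≤ 1 := (measureReal_mono (Set.subset_univ _)).trans hQ
      have h3 : 0 ≤ P.real B := measureReal_nonneg
      have h4 : 0 ≤ Q.real B := measureReal_nonneg
      rw [Real.norm_of_nonneg (sq_nonneg _), sq_le_one_iff_abs_le_one, abs_le]
      constructor <;> linarith
    have h1 : ∀ v, ‖∫ u, (P.real (Metric.closedBall u (dist v u))
        - Q.real (Metric.closedBall u (dist v u))) ^ 2 ∂S‖ ≤ 1 := fun v =>
      (norm_integral_le_of_norm_le_const (ae_of_all _ fun u => hb _)).trans (by simpa using hS)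
    exact (Real.le_norm_self _).trans
      ((norm_integral_le_of_norm_le_const (ae_of_all _ h1)).trans (by simpa using hS))
  have := key P inferInstance hP
  have := key Q inferInstance hQ
  rw [ballDivergence]
  linarith

lemma ballDivergence_self (P : Measure (E d)) : ballDivergence P P = 0 := by
  simp [ballDivergence]

lemma measurable_ballDivergence_kernel {α : Type*} [MeasurableSpace α] (κ η : Kernel α (E d))
    [IsFiniteKernel κ] [IsFiniteKernel η] :
    Measurable fun x => ballDivergence (κ x) (η x) := by
  have hq : ∀ (κ₀ κ₁ κ₂ : Kernel α (E d)) [IsFiniteKernel κ₀] [IsFiniteKernel κ₁]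
      [IsFiniteKernel κ₂], Measurable fun x => ballQuad (κ₀ x) (κ₁ x) (κ₂ x) := by
    intro κ₀ κ₁ κ₂ _ _ _
    have h := (Kernel.measurable_coe ((κ₀ ×ₖ κ₀) ×ₖ (κ₁ ×ₖ κ₂))
      (measurableSet_ballSet (d := d))).ennreal_toReal
    simpa only [Kernel.prod_apply, ballQuad] using h
  simp_rw [ballDivergence_eq]
  exact (((hq _ _ _).sub ((hq _ _ _).const_mul 2)).add (hq _ _ _)).add
    (((hq _ _ _).sub ((hq _ _ _).const_mul 2)).add (hq _ _ _))

/-- The frontier lies where one of the two distance inequalities is an equality. For fixed `(v, u)`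
this puts `x` or `x'` on a sphere, so only `R₁` and `R₂` need to be diffuse and `P` is arbitrary. -/
lemma prod_null_of_sphere_null {P R₁ R₂ : Measure (E d)} [SFinite P] [SFinite R₁] [SFinite R₂]
    (h₁ : ∀ (u : E d) r, R₁ (Metric.sphere u r) = 0)
    (h₂ : ∀ (u : E d) r, R₂ (Metric.sphere u r) = 0) :
    ((P.prod P).prod (R₁.prod R₂)) (frontier (ballSet d)) = 0 := by
  have hsub : frontier (ballSet d) ⊆ {q | dist q.2.1 q.1.2 = dist q.1.1 q.1.2} ∪
      {q | dist q.2.2 q.1.2 = dist q.1.1 q.1.2} := by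
    refine (frontier_inter_subset _ _).trans (Set.union_subset_union ?_ ?_)
    · exact Set.inter_subset_left.trans (frontier_le_subset_eq (by fun_prop) (by fun_prop))
    · exact Set.inter_subset_right.trans (frontier_le_subset_eq (by fun_prop) (by fun_prop))
  refine measure_mono_null hsub (measure_union_null ?_ ?_)
  · rw [Measure.measure_prod_null (measurableSet_eq_fun (by fun_prop) (by fun_prop))]
    refine ae_of_all _ fun q => ?_
    have : (Prod.mk q ⁻¹' {q : (E d × E d) × (E d × E d) | dist q.2.1 q.1.2 = dist q.1.1 q.1.2})
        = Metric.sphere q.2 (dist q.1 q.2) ×ˢ (Set.univ : Set (E d)) := by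
      ext ⟨x, x'⟩; simp [dist_eq_norm]
    change (R₁.prod R₂) (Prod.mk q ⁻¹' _) = 0
    rw [this, Measure.prod_prod, h₁]; simp
  · rw [Measure.measure_prod_null (measurableSet_eq_fun (by fun_prop) (by fun_prop))]
    refine ae_of_all _ fun q => ?_
    have : (Prod.mk q ⁻¹' {q : (E d × E d) × (E d × E d) | dist q.2.2 q.1.2 = dist q.1.1 q.1.2})
        = (Set.univ : Set (E d)) ×ˢ Metric.sphere q.2 (dist q.1 q.2) := by
      ext ⟨x, x'⟩; simp [dist_eq_norm]
    change (R₁.prod R₂) (Prod.mk q ⁻¹' _) = 0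
    rw [this, Measure.prod_prod, h₂]; simp

/-- Products of probability measures are jointly weakly continuous, and the portmanteau theorem
applies to a set with null frontier. -/
lemma tendsto_ballQuad {ι : Type*} {l : Filter ι} {P R₁ R₂ : ι → ProbabilityMeasure (E d)}
    {P' R₁' R₂' : ProbabilityMeasure (E d)} (hP : Tendsto P l (𝓝 P')) (hR₁ : Tendsto R₁ l (𝓝 R₁'))
    (hR₂ : Tendsto R₂ l (𝓝 R₂'))
    (h₁ : ∀ (u : E d) r, (R₁' : Measure (E d)) (Metric.sphere u r) = 0)
    (h₂ : ∀ (u : E d) r, (R₂' : Measure (E d)) (Metric.sphere u r) = 0) :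
    Tendsto (fun i => ballQuad (P i : Measure (E d)) (R₁ i : Measure (E d))
      (R₂ i : Measure (E d))) l
      (𝓝 (ballQuad (P' : Measure (E d)) (R₁' : Measure (E d)) (R₂' : Measure (E d)))) := by
  have hPP := (ProbabilityMeasure.continuous_prod.tendsto (P', P')).comp (hP.prodMk_nhds hP)
  have hRR := (ProbabilityMeasure.continuous_prod.tendsto (R₁', R₂')).comp (hR₁.prodMk_nhds hR₂)
  have h4 := (ProbabilityMeasure.continuous_prod.tendsto (P'.prod P', R₁'.prod R₂')).comp
    (hPP.prodMk_nhds hRR)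
  have := ProbabilityMeasure.tendsto_measure_of_null_frontier_of_tendsto' h4
    (E := ballSet d) (prod_null_of_sphere_null h₁ h₂)
  exact (ENNReal.tendsto_toReal (measure_ne_top _ _)).comp this

/-- The ball divergence is weakly continuous at laws that do not charge spheres. -/
lemma tendsto_ballDivergence {ι : Type*} {l : Filter ι} {P Q : ι → ProbabilityMeasure (E d)}
    {P' Q' : ProbabilityMeasure (E d)} (hP : Tendsto P l (𝓝 P')) (hQ : Tendsto Q l (𝓝 Q'))
    (h₁ : ∀ (u : E d) r, (P' : Measure (E d)) (Metric.sphere u r) = 0)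
    (h₂ : ∀ (u : E d) r, (Q' : Measure (E d)) (Metric.sphere u r) = 0) :
    Tendsto (fun i => ballDivergence (P i : Measure (E d)) (Q i : Measure (E d))) l
      (𝓝 (ballDivergence (P' : Measure (E d)) (Q' : Measure (E d)))) := by
  simp_rw [ballDivergence_eq]
  exact (((tendsto_ballQuad hP hP hP h₁ h₁).sub ((tendsto_ballQuad hP hP hQ h₁ h₂).const_mul 2)).add
    (tendsto_ballQuad hP hQ hQ h₂ h₂)).add
    (((tendsto_ballQuad hQ hP hP h₁ h₁).sub ((tendsto_ballQuad hQ hP hQ h₁ h₂).const_mul 2)).add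
    (tendsto_ballQuad hQ hQ hQ h₂ h₂))

/-- The ball divergence separates diffuse laws. -/
lemma eq_of_ballDivergence_eq_zero {P Q : Measure (E d)} [IsProbabilityMeasure P]
    [IsProbabilityMeasure Q] (hP : ∀ u, P {u} = 0) (h : ballDivergence P Q = 0) : P = Q := by
  have h0 : ∫ v, ∫ u, (P.real (Metric.closedBall u (dist v u))
      - Q.real (Metric.closedBall u (dist v u))) ^ 2 ∂P ∂P = 0 := by
    have h1 : 0 ≤ ∫ v, ∫ u, (P.real (Metric.closedBall u (dist v u))
      - Q.real (Metric.closedBall u (dist v u))) ^ 2 ∂P ∂P :=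
      integral_nonneg fun _ => integral_nonneg fun _ => sq_nonneg _
    have h2 : 0 ≤ ∫ v, ∫ u, (P.real (Metric.closedBall u (dist v u))
      - Q.real (Metric.closedBall u (dist v u))) ^ 2 ∂Q ∂Q :=
      integral_nonneg fun _ => integral_nonneg fun _ => sq_nonneg _
    rw [ballDivergence] at h
    linarith
  rw [← integral_prod _ (integrable_ball_sub_sq P P Q),
    integral_eq_zero_iff_of_nonneg (fun _ => sq_nonneg _) (integrable_ball_sub_sq P P Q)] at h0
  have hae : ∀ᵐ u ∂P, ∀ᵐ v ∂P, P.real (Metric.closedBall u (dist v u))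
      = Q.real (Metric.closedBall u (dist v u)) := by
    have h1 := (Measure.measurePreserving_swap (μ := P) (ν := P)).quasiMeasurePreserving.ae h0
    filter_upwards [Measure.ae_ae_of_ae_prod h1] with u hu
    filter_upwards [hu] with v hv
    simpa [sub_eq_zero] using hv
  -- By Besicovitch differentiation the derivative is the limit of `Q / P` over shrinking balls
  -- about `u`. If it were not `1`, the two laws would differ on every small ball, so every `v ≠ u`
  -- near `u` would lie in the `P`-null set of radii where they disagree. A whole ball about `u`
  -- would then be `P`-null.
  have hder : ∀ᵐ u ∂P, Q.rnDeriv P u = 1 := by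
    filter_upwards [hae, Besicovitch.ae_tendsto_rnDeriv Q P,
      (Besicovitch.vitaliFamily P).ae_eventually_measure_pos] with u hu hlim hpos
    have hpos' : ∀ᶠ r in 𝓝[>] (0 : ℝ), 0 < P (Metric.closedBall u r) :=
      (Besicovitch.tendsto_filterAt P u).eventually hpos
    by_contra hne
    obtain ⟨ε, hε, hεr⟩ := mem_nhdsGT_iff_exists_Ioc_subset.1
      ((hlim.eventually_ne hne).and hpos')
    have hnull : P (Metric.closedBall u ε) = 0 := by
      refine measure_mono_null (t := {u} ∪ {v | ¬ (P.real (Metric.closedBall u (dist v u))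
        = Q.real (Metric.closedBall u (dist v u)))}) ?_ (measure_union_null (hP u) hu)
      intro v hv
      by_cases hvu : v = u
      · exact Or.inl hvu
      · refine Or.inr fun heq => ?_
        obtain ⟨h1, h2⟩ := hεr (show dist v u ∈ Set.Ioc 0 ε from ⟨dist_pos.2 hvu, hv⟩)
        refine h1 ?_
        have : P (Metric.closedBall u (dist v u)) = Q (Metric.closedBall u (dist v u)) :=
          (ENNReal.toReal_eq_toReal_iff' (measure_ne_top _ _) (measure_ne_top _ _)).1 heq
        rw [← this, ENNReal.div_self h2.ne' (measure_ne_top _ _)]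
    exact (hεr (show ε ∈ Set.Ioc 0 ε from ⟨hε, le_rfl⟩)).2.ne' hnull
  -- The absolutely continuous part of `Q` is already `P`, and equal total mass leaves no room for a
  -- singular part.
  have hle : P ≤ Q := by
    have := Measure.withDensity_rnDeriv_le Q P
    rwa [withDensity_congr_ae hder, withDensity_const, one_smul] at this
  exact Measure.eq_of_le_of_isProbabilityMeasure hle

end BallDivergence

/-! ### The law of a resampled observation -/

/-- The law of `(X', Y, Z)` where `X' ∼ Q(Z)` is drawn independently of `Y` given `Z`. -/
def resampledLaw (μ : Measure (Obs dX dY dZ)) (Q : Kernel (E dZ) (E dX)) :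
    Measure (Obs dX dY dZ) :=
  (μ ⊗ₘ (Q.comap (fun w : Obs dX dY dZ => w.2.2) (by fun_prop))).map (fun q => (q.2, q.1.2))

lemma IsCondLawXZ.map_eq {μ : Measure (Obs dX dY dZ)} {Q : Kernel (E dZ) (E dX)}
    (hQ : IsCondLawXZ μ Q) :
    μ.map (fun w => (w.2.2, w.1)) = μ.map (fun w => w.2.2) ⊗ₘ Q := by
  have h := hQ.disintegrate
  rw [Measure.fst, Measure.map_map (by fun_prop) (by fun_prop)] at h
  exact h.symm

section ResampledLaw

variable (μ : Measure (Obs dX dY dZ)) [IsProbabilityMeasure μ]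
  (Q : Kernel (E dZ) (E dX)) [IsMarkovKernel Q]

instance : IsProbabilityMeasure (resampledLaw μ Q) :=
  Measure.isProbabilityMeasure_map (by fun_prop)

lemma resampledLaw_apply {s : Set (Obs dX dY dZ)} (hs : MeasurableSet s) :
    resampledLaw μ Q s = ∫⁻ w, Q w.2.2 {x | (x, w.2) ∈ s} ∂μ := by
  rw [resampledLaw, Measure.map_apply (by fun_prop) hs,
    Measure.compProd_apply (hs.preimage (by fun_prop))]
  rfl

lemma map_snd_resampledLaw : (resampledLaw μ Q).map (fun w => w.2) = μ.map (fun w => w.2) := by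
  ext s hs
  rw [Measure.map_apply measurable_snd hs, Measure.map_apply measurable_snd hs,
    resampledLaw_apply _ _ (measurable_snd hs)]
  rw [← lintegral_indicator_one (measurable_snd hs)]
  refine lintegral_congr fun w => ?_
  by_cases hw : w.2 ∈ s <;> simp [hw]

/-- After resampling, the law of `X` given `(Y, Z)` reads only `Z`. This is what makes the limit of
the statistic vanish on resampled data. -/
lemma map_yzx_resampledLaw :
    (resampledLaw μ Q).map (fun w => (w.2, w.1))
      = (resampledLaw μ Q).map (fun w => w.2) ⊗ₘ (Q.comap Prod.snd measurable_snd) := by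
  rw [map_snd_resampledLaw]
  ext s hs
  rw [Measure.map_apply (by fun_prop) hs, resampledLaw_apply _ _ (hs.preimage (by fun_prop)),
    Measure.compProd_apply hs, lintegral_map (Kernel.measurable_kernel_prodMk_left hs) (by fun_prop)]
  rfl

lemma map_zx_resampledLaw :
    (resampledLaw μ Q).map (fun w => (w.2.2, w.1))
      = (resampledLaw μ Q).map (fun w => w.2.2) ⊗ₘ Q := by
  have h : (resampledLaw μ Q).map (fun w => w.2.2) = μ.map (fun w => w.2.2) := by
    have := congrArg (Measure.map Prod.snd) (map_snd_resampledLaw μ Q)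
    rwa [Measure.map_map (by fun_prop) (by fun_prop),
      Measure.map_map (by fun_prop) (by fun_prop)] at this
  rw [h]
  ext s hs
  rw [Measure.map_apply (by fun_prop) hs, resampledLaw_apply _ _ (hs.preimage (by fun_prop)),
    Measure.compProd_apply hs, lintegral_map (Kernel.measurable_kernel_prodMk_left hs) (by fun_prop)]
  rfl

variable {μ Q}

/-- Conditional independence means that resampling does not change the law. -/
lemma condIndep_iff_map_eq (hQ : IsCondLawXZ μ Q) :
    CondIndep μ ↔ μ.map (fun w => ((w.2.2, w.2.1), w.1))
      = μ.map (fun w => (w.2.2, w.2.1)) ⊗ₘ Q.prodMkRight (E dY) := by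
  have hX : Measurable fun w : Obs dX dY dZ => w.1 := by fun_prop
  have hY : Measurable fun w : Obs dX dY dZ => w.2.1 := by fun_prop
  have hZ : Measurable fun w : Obs dX dY dZ => w.2.2 := by fun_prop
  have h1 : CondIndep μ ↔ condDistrib (fun w : Obs dX dY dZ => w.1)
      (fun w => (w.2.2, w.2.1)) μ =ᵐ[μ.map (fun w => (w.2.2, w.2.1))]
      (condDistrib (fun w : Obs dX dY dZ => w.1) (fun w => w.2.2) μ).prodMkRight (E dY) := by
    rw [← condIndepFun_iff_condDistrib_prod_ae_eq_prodMkRight hX hY hZ]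
    exact ⟨fun h => h.symm, fun h => h.symm⟩
  -- Conditional laws are unique almost everywhere, so the given version `Q` may replace Mathlib's
  -- `condDistrib`; the null set in `z` is then pulled back to `(z, y)`.
  have h2 := condDistrib_ae_eq_of_measure_eq_compProd (μ := μ) (fun w : Obs dX dY dZ => w.2.2)
    hX.aemeasurable hQ.map_eq
  have h3 : (condDistrib (fun w : Obs dX dY dZ => w.1) (fun w => w.2.2) μ).prodMkRight (E dY)
      =ᵐ[μ.map (fun w => (w.2.2, w.2.1))] Q.prodMkRight (E dY) := by
    have hm : Measurable fun w : Obs dX dY dZ => (w.2.2, w.2.1) := by fun_prop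
    have h4 : μ.map (fun w => w.2.2) = (μ.map (fun w => (w.2.2, w.2.1))).map Prod.fst := by
      rw [Measure.map_map measurable_fst hm]; rfl
    rw [h4] at h2
    exact ae_of_ae_map measurable_fst.aemeasurable h2
  rw [h1, ← condDistrib_ae_eq_iff_measure_eq_compProd _ hX.aemeasurable]
  exact ⟨fun h => h.trans h3, fun h => h.trans h3.symm⟩

/-- The form of the null hypothesis used in both halves: `μ` is a fixed point of resampling. It is
the disintegration over `(z, y)` with the coordinates reordered. -/
lemma condIndep_iff_resampledLaw_eq (hQ : IsCondLawXZ μ Q) :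
    CondIndep μ ↔ resampledLaw μ Q = μ := by
  rw [condIndep_iff_map_eq hQ]
  have key : ∀ s : Set ((E dZ × E dY) × E dX), MeasurableSet s →
      (μ.map (fun w => (w.2.2, w.2.1)) ⊗ₘ Q.prodMkRight (E dY)) s
        = resampledLaw μ Q ((fun w => ((w.2.2, w.2.1), w.1)) ⁻¹' s) := fun s hs => by
    rw [resampledLaw_apply _ _ (hs.preimage (by fun_prop)), Measure.compProd_apply hs,
      lintegral_map (Kernel.measurable_kernel_prodMk_left hs) (by fun_prop)]
    rfl
  constructor
  · intro h
    ext s hs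
    have hm : MeasurableSet ((fun q : (E dZ × E dY) × E dX => (q.2, q.1.2, q.1.1)) ⁻¹' s) :=
      hs.preimage (by fun_prop)
    have h1 := key _ hm
    rw [← h, Measure.map_apply (by fun_prop) hm] at h1
    exact h1.symm
  · intro h
    ext s hs
    rw [key s hs, h, Measure.map_apply (by fun_prop) hs]

variable (μ Q)

lemma resample_apply_section {n : ℕ} (D : Fin n → Obs dX dY dZ) (s : Fin n → Set (Obs dX dY dZ)) :
    resample Q n D {x | replaceX D x ∈ Set.univ.pi s} = ∏ i, Q (D i).2.2 {x | (x, (D i).2) ∈ s i} := by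
  have h : {x | replaceX D x ∈ Set.univ.pi s}
      = Set.univ.pi fun i => {x : E dX | (x, (D i).2) ∈ s i} := by
    ext x; simp [replaceX]
  rw [h]
  exact Measure.pi_pi _ _

lemma measurable_replaceX {n : ℕ} : Measurable
    (fun ω : (Fin n → Obs dX dY dZ) × (Fin n → E dX) => replaceX ω.1 ω.2) := by
  unfold replaceX
  fun_prop

/-- A resampled data set is an i.i.d. sample from the resampled law. -/
lemma map_replaceX_compProd_resample (n : ℕ) :
    ((Measure.pi fun _ : Fin n => μ) ⊗ₘ resample Q n).map (fun ω => replaceX ω.1 ω.2)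
      = Measure.pi fun _ : Fin n => resampledLaw μ Q := by
  symm
  refine Measure.pi_eq fun s hs => ?_
  have hms : MeasurableSet (Set.univ.pi s) := MeasurableSet.univ_pi hs
  have hg : ∀ i, Measurable fun w : Obs dX dY dZ => Q w.2.2 {x | (x, w.2) ∈ s i} := fun i =>
    Kernel.measurable_kernel_prodMk_left (κ := Q.comap (fun w : Obs dX dY dZ => w.2.2) (by fun_prop))
      (t := {q | (q.2, q.1.2) ∈ s i}) ((hs i).preimage (by fun_prop))
  rw [Measure.map_apply measurable_replaceX hms,
    Measure.compProd_apply (measurable_replaceX hms)]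
  have h1 : ∀ D : Fin n → Obs dX dY dZ,
      resample Q n D (Prod.mk D ⁻¹' ((fun ω => replaceX ω.1 ω.2) ⁻¹' Set.univ.pi s))
        = ∏ i, Q (D i).2.2 {x | (x, (D i).2) ∈ s i} := fun D => resample_apply_section Q D s
  simp_rw [h1]
  -- Given the data the resamples are independent over `i`, with a law depending on the `i`-th
  -- observation only; independence of the observations then factors the integral.
  rw [lintegral_prod_eq_prod_lintegral_of_indepFun Finset.univ
    (fun i (D : Fin n → Obs dX dY dZ) => Q (D i).2.2 {x | (x, (D i).2) ∈ s i})
    (iIndepFun_pi (μ := fun _ : Fin n => μ)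
      (X := fun i (w : Obs dX dY dZ) => Q w.2.2 {x | (x, w.2) ∈ s i})
      fun i => (hg i).aemeasurable) fun i => (hg i).comp (measurable_pi_apply i)]
  refine Finset.prod_congr rfl fun i _ => ?_
  rw [resampledLaw_apply _ _ (hs i)]
  exact (measurePreserving_eval (fun _ : Fin n => μ) i).lintegral_comp (hg i)

end ResampledLaw

/-! ### Validity of the test under conditional independence -/

/-- Among the indices counted, take one with the smallest value. All the others have values at least
as large, so they are among the fewer than `c` indices at or above it. Ties need no separate
treatment. -/
lemma card_rank_lt_le {m : ℕ} (t : Fin m → ℝ) (c : ℝ) (hc : 0 ≤ c) :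
    (∑ k, if (∑ j, if t j ≥ t k then (1 : ℝ) else 0) < c then (1 : ℝ) else 0) ≤ c := by
  rw [← Finset.sum_filter, Finset.sum_const, nsmul_eq_mul, mul_one]
  set A := Finset.univ.filter fun k => (∑ j, if t j ≥ t k then (1 : ℝ) else 0) < c with hA
  rcases A.eq_empty_or_nonempty with h | h
  · simpa [h] using hc
  · obtain ⟨k, hkA, hk⟩ := A.exists_min_image t h
    have h1 : (∑ j, if t j ≥ t k then (1 : ℝ) else 0) < c := (Finset.mem_filter.1 hkA).2
    refine le_trans ?_ h1.le
    rw [← Finset.sum_filter, Finset.sum_const, nsmul_eq_mul, mul_one]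
    exact_mod_cast Finset.card_le_card fun j hj => Finset.mem_filter.2 ⟨Finset.mem_univ _, hk j hj⟩

lemma map_comp_perm_pi {𝒳 : Type*} [MeasurableSpace 𝒳] (ρ : Measure 𝒳) [IsProbabilityMeasure ρ]
    {m : ℕ} (σ : Equiv.Perm (Fin m)) :
    (Measure.pi fun _ : Fin m => ρ).map (fun x i => x (σ i)) = Measure.pi fun _ => ρ := by
  symm
  refine Measure.pi_eq fun s hs => ?_
  rw [Measure.map_apply (by fun_prop) (MeasurableSet.univ_pi hs)]
  have : (fun (x : Fin m → 𝒳) i => x (σ i)) ⁻¹' Set.univ.pi s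
      = Set.univ.pi fun i => s (σ.symm i) := by
    ext x
    simp only [Set.mem_preimage, Set.mem_univ_pi]
    exact ⟨fun h i => by simpa using h (σ.symm i), fun h i => by simpa using h (σ i)⟩
  rw [this, Measure.pi_pi]
  exact Equiv.prod_comp σ.symm fun i => ρ (s i)

/-- The rank of one of `m + 1` exchangeable values is at least uniform. -/
lemma pi_rank_lt_le {𝒳 : Type*} [MeasurableSpace 𝒳] (ρ : Measure 𝒳) [IsProbabilityMeasure ρ]
    {τ : 𝒳 → ℝ} (hτ : Measurable τ) (m : ℕ) {α : ℝ} (hα : 0 ≤ α) :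
    (Measure.pi fun _ : Fin (m + 1) => ρ)
      {x | (∑ j, if τ (x j) ≥ τ (x 0) then (1 : ℝ) else 0) < α * ((m : ℝ) + 1)}
      ≤ ENNReal.ofReal α := by
  set c : ℝ := α * ((m : ℝ) + 1) with hc
  have hc0 : 0 ≤ c := by positivity
  let A : Fin (m + 1) → Set (Fin (m + 1) → 𝒳) := fun k =>
    {x | (∑ j, if τ (x j) ≥ τ (x k) then (1 : ℝ) else 0) < c}
  have hA : ∀ k, MeasurableSet (A k) := fun k => by
    refine measurableSet_lt (Finset.measurable_sum _ fun j _ => ?_) measurable_const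
    exact Measurable.ite (measurableSet_le (by fun_prop) (by fun_prop)) measurable_const
      measurable_const
  -- Swapping the coordinates `0` and `k` preserves the product measure and only permutes the inner
  -- sum. With the counting bound, `m + 1` equal probabilities sum to at most `α * (m + 1)`.
  have hsymm : ∀ k, (Measure.pi fun _ : Fin (m + 1) => ρ) (A k)
      = (Measure.pi fun _ : Fin (m + 1) => ρ) (A 0) := fun k => by
    conv_rhs => rw [← map_comp_perm_pi ρ (Equiv.swap 0 k), Measure.map_apply (by fun_prop) (hA 0)]
    congr 1
    ext x
    simp only [A, Set.mem_ofPred_eq, Set.mem_preimage, Equiv.swap_apply_left]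
    rw [Equiv.sum_comp (Equiv.swap 0 k) fun j => if τ (x j) ≥ τ (x k) then (1 : ℝ) else 0]
  have hsum : ∑ k, (Measure.pi fun _ : Fin (m + 1) => ρ) (A k) ≤ ENNReal.ofReal c := by
    calc ∑ k, (Measure.pi fun _ : Fin (m + 1) => ρ) (A k)
        = ∫⁻ x, ∑ k, (A k).indicator 1 x ∂(Measure.pi fun _ : Fin (m + 1) => ρ) := by
          rw [lintegral_finsetSum _ fun k _ => measurable_one.indicator (hA k)]
          simp_rw [lintegral_indicator_one (hA _)]
      _ ≤ ∫⁻ _, ENNReal.ofReal c ∂(Measure.pi fun _ : Fin (m + 1) => ρ) := by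
          refine lintegral_mono fun x => ?_
          have h1 : ∀ k, (A k).indicator (1 : (Fin (m + 1) → 𝒳) → ℝ≥0∞) x = ENNReal.ofReal
              (if (∑ j, if τ (x j) ≥ τ (x k) then (1 : ℝ) else 0) < c then (1 : ℝ) else 0) := by
            intro k
            by_cases hk : x ∈ A k
            · rw [Set.indicator_of_mem hk, if_pos (by exact hk)]; simp
            · rw [Set.indicator_of_notMem hk, if_neg (by exact hk)]; simp
          simp_rw [h1]
          rw [← ENNReal.ofReal_sum_of_nonneg fun k _ => by split_ifs <;> norm_num]
          exact ENNReal.ofReal_le_ofReal (card_rank_lt_le (fun j => τ (x j)) c hc0)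
      _ = ENNReal.ofReal c := by simp
  simp_rw [hsymm] at hsum
  rw [Finset.sum_const, Finset.card_univ, Fintype.card_fin, nsmul_eq_mul, hc, mul_comm α,
    ENNReal.ofReal_mul (by positivity)] at hsum
  have h2 : ENNReal.ofReal ((m : ℝ) + 1) = ((m + 1 : ℕ) : ℝ≥0∞) := by
    rw [← ENNReal.ofReal_natCast]; push_cast; rfl
  rw [h2] at hsum
  exact (ENNReal.mul_le_mul_iff_right (by simp) (by simp)).1 hsum

lemma measurable_pCRT {n M : ℕ} {T : (Fin n → Obs dX dY dZ) → ℝ} (hT : Measurable T) :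
    Measurable (pCRT (M := M) T) := by
  unfold pCRT
  refine Measurable.div_const (Measurable.const_add (Finset.measurable_sum _ fun j _ => ?_) _) _
  refine Measurable.ite (measurableSet_le (hT.comp measurable_fst) ?_) measurable_const
    measurable_const
  exact hT.comp (measurable_replaceX.comp (measurable_fst.prodMk (by fun_prop)))

/-- The conditional randomization test is valid for every measurable statistic. -/
lemma crtLaw_pCRT_lt_le {μ : Measure (Obs dX dY dZ)} [IsProbabilityMeasure μ]
    {Q : Kernel (E dZ) (E dX)} [IsMarkovKernel Q] (hμ : resampledLaw μ Q = μ) {n M : ℕ}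
    {T : (Fin n → Obs dX dY dZ) → ℝ} (hT : Measurable T) {α : ℝ} (hα : 0 ≤ α) :
    crtLaw μ Q n M {ω | pCRT T ω < α} ≤ ENNReal.ofReal α := by
  have hS : MeasurableSet {ω : (Fin n → Obs dX dY dZ) × (Fin M → Fin n → E dX) | pCRT T ω < α} :=
    measurableSet_lt (measurable_pCRT hT) measurable_const
  have hm := Kernel.measurable_kernel_prodMk_left
    (κ := piKernel fun _ : Fin M => resample (dY := dY) Q n) hS
  rw [crtLaw, Measure.compProd_apply hS]
  -- The observed sample is realised as a resample of an auxiliary sample with the same law.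
  have h1 : (Measure.pi fun _ : Fin n => μ)
      = ((Measure.pi fun _ : Fin n => μ) ⊗ₘ resample Q n).map (fun ω => replaceX ω.1 ω.2) := by
    rw [map_replaceX_compProd_resample, hμ]
  rw [h1, lintegral_map hm measurable_replaceX]
  refine (le_of_eq (Measure.lintegral_compProd (hm.comp measurable_replaceX))).trans ?_
  refine (lintegral_mono (g := fun _ => ENNReal.ofReal α) fun D => ?_).trans (by simp)
  set ρ : Measure (Fin n → E dX) := resample Q n D with hρ
  have hτ : Measurable fun x : Fin n → E dX => T (replaceX D x) :=
    hT.comp (measurable_replaceX.comp measurable_prodMk_left)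
  let S' : Set ((Fin n → E dX) × (Fin M → Fin n → E dX)) :=
    (fun q => (replaceX D q.1, q.2)) ⁻¹' {ω | pCRT T ω < α}
  have hS' : MeasurableSet S' := hS.preimage
    ((measurable_replaceX.comp (measurable_const.prodMk measurable_fst)).prodMk measurable_snd)
  -- The resampling kernel sees only the `Z`-entries, which `replaceX` keeps; hence, given `D`, the
  -- observed `X`-entries and the `M` resamples are `M + 1` independent draws from `ρ`.
  have h2 : ∫⁻ x, (piKernel fun _ : Fin M => resample Q n) (replaceX D x)
      (Prod.mk (replaceX D x) ⁻¹' {ω | pCRT T ω < α}) ∂ρ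
      = (ρ.prod (Measure.pi fun _ : Fin M => ρ)) S' := by
    rw [Measure.prod_apply hS']
    rfl
  refine (le_of_eq h2).trans ?_
  have h3 := measurePreserving_piFinSuccAbove (fun _ : Fin (M + 1) => ρ) 0
  rw [← h3.measure_preimage hS'.nullMeasurableSet]
  refine (measure_mono ?_).trans (pi_rank_lt_le ρ hτ M hα)
  intro x hx
  have hx' : pCRT T (replaceX D (x 0), fun j : Fin M => x j.succ) < α := hx
  rw [pCRT, div_lt_iff₀ (by positivity)] at hx'
  simp only [Set.mem_ofPred_eq]
  -- The `1 +` in the `p`-value is the term `j = 0`, where the observed statistic is compared with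
  -- itself.
  rw [Fin.sum_univ_succ, if_pos le_rfl, add_comm (M : ℝ)]
  exact hx'

/-! ### Consistency of the statistic -/

lemma weightedEmpirical_real_univ_le_one {d n : ℕ} {w : Fin n → ℝ} (hw : ∀ i, 0 ≤ w i)
    (x : Fin n → E d) : (weightedEmpirical w x).real Set.univ ≤ 1 := by
  rw [weightedEmpirical_real hw x MeasurableSet.univ]
  simpa using div_self_le_one (∑ i, w i)

/-- Packaging the estimates as finite kernels of the data makes the statistic measurable through
`measurable_ballDivergence_kernel`. -/
lemma exists_kernel_weightedEmpirical {α : Type*} [MeasurableSpace α] {d n : ℕ}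
    {w : α → Fin n → ℝ} (hw : ∀ i, Measurable fun t => w t i) (hw0 : ∀ t i, 0 ≤ w t i)
    {x : α → Fin n → E d} (hx : ∀ i, Measurable fun t => x t i) :
    ∃ κ : Kernel α (E d), IsFiniteKernel κ ∧ ∀ t, κ t = weightedEmpirical (w t) (x t) := by
  refine ⟨⟨fun t => weightedEmpirical (w t) (x t), ?_⟩, ⟨1, ENNReal.one_lt_top, fun t => ?_⟩,
    fun t => rfl⟩
  · refine Measure.measurable_of_measurable_coe _ fun s hs => ?_
    simp only [weightedEmpirical, Measure.finsetSum_apply, Measure.smul_apply, smul_eq_mul]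
    refine Finset.measurable_sum _ fun i _ => ?_
    refine ((hw i).div (Finset.measurable_sum _ fun j _ => hw j)).ennreal_ofReal.mul ?_
    exact (Measure.measurable_coe hs).comp (Measure.measurable_dirac.comp (hx i))
  · have := weightedEmpirical_real_univ_le_one (hw0 t) (x t)
    rw [Measure.real] at this
    exact (ENNReal.toReal_le_toReal (measure_ne_top (weightedEmpirical (w t) (x t)) _)
      ENNReal.one_ne_top).1 (by simpa using this)

/-- The contribution of the `s`-th observation to the statistic. -/
def zetaTerm {n : ℕ} (a : E dY × E dZ → ℝ) (K₁ K₂ : ℝ → ℝ) (h₁ h₂ : ℝ)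
    (D : Fin n → Obs dX dY dZ) (s : Fin n) : ℝ :=
  ballDivergence (estXgivenYZ K₁ h₁ D (D s).2.1 (D s).2.2)
    (estXgivenZ K₂ h₂ D (D s).2.2) * a (D s).2

section Statistic

variable {a : E dY × E dZ → ℝ} {K₁ K₂ : ℝ → ℝ}

lemma measurable_zetaTerm (ha : Measurable a) (hK₁m : Measurable K₁) (hK₂m : Measurable K₂)
    (hK₁ : ∀ t, 0 ≤ K₁ t) (hK₂ : ∀ t, 0 ≤ K₂ t) (h₁ h₂ : ℝ) {n : ℕ} (s : Fin n) :
    Measurable fun D : Fin n → Obs dX dY dZ => zetaTerm a K₁ K₂ h₁ h₂ D s := by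
  obtain ⟨κ, _, hκ⟩ := exists_kernel_weightedEmpirical
    (w := fun (D : Fin n → Obs dX dY dZ) i =>
      K₁ (‖(WithLp.toLp 2 (D s).2 - WithLp.toLp 2 (D i).2 : EYZ dY dZ)‖ / h₁))
    (fun i => hK₁m.comp (by fun_prop)) (fun _ _ => hK₁ _) (x := fun D i => (D i).1)
    (fun i => by fun_prop)
  obtain ⟨η, _, hη⟩ := exists_kernel_weightedEmpirical
    (w := fun (D : Fin n → Obs dX dY dZ) i => K₂ (‖(D s).2.2 - (D i).2.2‖ / h₂))
    (fun i => hK₂m.comp (by fun_prop)) (fun _ _ => hK₂ _) (x := fun D i => (D i).1)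
    (fun i => by fun_prop)
  have h := measurable_ballDivergence_kernel κ η
  simp_rw [hκ, hη] at h
  exact h.mul (ha.comp (by fun_prop))

lemma zetaHat_eq_sum_zetaTerm (h₁ h₂ : ℝ) {n : ℕ} (D : Fin n → Obs dX dY dZ) :
    zetaHat a K₁ K₂ h₁ h₂ D = (1 / (n : ℝ)) * ∑ s, zetaTerm a K₁ K₂ h₁ h₂ D s := rfl

lemma measurable_zetaHat (ha : Measurable a) (hK₁m : Measurable K₁) (hK₂m : Measurable K₂)
    (hK₁ : ∀ t, 0 ≤ K₁ t) (hK₂ : ∀ t, 0 ≤ K₂ t) (h₁ h₂ : ℝ) {n : ℕ} :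
    Measurable fun D : Fin n → Obs dX dY dZ => zetaHat a K₁ K₂ h₁ h₂ D :=
  (Finset.measurable_sum _ fun s _ =>
    measurable_zetaTerm ha hK₁m hK₂m hK₁ hK₂ h₁ h₂ s).const_mul _

lemma zetaTerm_mem_Icc (hK₁ : ∀ t, 0 ≤ K₁ t) (hK₂ : ∀ t, 0 ≤ K₂ t) (h₁ h₂ : ℝ) {C : ℝ} (ha0 : ∀ v, 0 ≤ a v) (haC : ∀ v, a v ≤ C) {n : ℕ}
    (D : Fin n → Obs dX dY dZ) (s : Fin n) :
    zetaTerm a K₁ K₂ h₁ h₂ D s ∈ Set.Icc 0 (2 * C) := by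
  have : IsFiniteMeasure (estXgivenYZ K₁ h₁ D (D s).2.1 (D s).2.2) := by
    unfold estXgivenYZ; infer_instance
  have : IsFiniteMeasure (estXgivenZ K₂ h₂ D (D s).2.2) := by
    unfold estXgivenZ; infer_instance
  refine ⟨mul_nonneg (ballDivergence_nonneg _ _) (ha0 _), ?_⟩
  exact mul_le_mul (ballDivergence_le_two
    (weightedEmpirical_real_univ_le_one (fun _ => hK₁ _) _)
    (weightedEmpirical_real_univ_le_one (fun _ => hK₂ _) _)) (haC _) (ha0 _) zero_le_two

end Statistic

/-- Replacing one entry of an i.i.d. sample by an independent observation does not change its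
law. -/
lemma map_update_prod_pi {W : Type*} [MeasurableSpace W] (ν : Measure W) [IsProbabilityMeasure ν]
    {m : ℕ} (s : Fin m) :
    (ν.prod (Measure.pi fun _ : Fin m => ν)).map (fun q => Function.update q.2 s q.1)
      = Measure.pi fun _ : Fin m => ν := by
  symm
  refine Measure.pi_eq fun A hA => ?_
  have hm : Measurable fun q : W × (Fin m → W) => Function.update q.2 s q.1 := by
    refine measurable_pi_iff.2 fun i => ?_
    by_cases hi : i = s
    · subst hi; simpa using measurable_fst
    · simp only [Function.update_of_ne hi]; fun_prop
  rw [Measure.map_apply hm (MeasurableSet.univ_pi hA)]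
  have : (fun q : W × (Fin m → W) => Function.update q.2 s q.1) ⁻¹' Set.univ.pi A
      = A s ×ˢ Set.univ.pi (Function.update A s Set.univ) := by
    ext q
    simp only [Set.mem_preimage, Set.mem_univ_pi, Set.mem_prod]
    constructor
    · intro h
      refine ⟨by simpa using h s, fun i => ?_⟩
      by_cases hi : i = s
      · subst hi; simp
      · simpa [Function.update_of_ne hi] using h i
    · rintro ⟨h1, h2⟩ i
      by_cases hi : i = s
      · subst hi; simpa using h1
      · simpa [Function.update_of_ne hi] using h2 i
  rw [this, Measure.prod_prod, Measure.pi_pi, ← Finset.mul_prod_erase _ _ (Finset.mem_univ s),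
    ← Finset.mul_prod_erase _ _ (Finset.mem_univ s)]
  simp only [Function.update_self, measure_univ, one_mul]
  congr 1
  refine Finset.prod_congr rfl fun i hi => ?_
  rw [Function.update_of_ne (Finset.ne_of_mem_erase hi)]

/-- Used to carry the disintegration over `(y, z)` from the plain product to `WithLp 2`, where the
kernel weights use the Euclidean norm. -/
lemma map_prodMk_eq_compProd_comap {W F G 𝒳 : Type*} [MeasurableSpace W] [MeasurableSpace F]
    [MeasurableSpace G] [MeasurableSpace 𝒳] {ν : Measure W} [IsFiniteMeasure ν] {V : W → F}
    (hV : Measurable V) {X : W → 𝒳} (hX : Measurable X) {κ : Kernel F 𝒳} [IsMarkovKernel κ]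
    (hκ : ν.map (fun w => (V w, X w)) = ν.map V ⊗ₘ κ) {e : F → G} (he : Measurable e) {e' : G → F}
    (he' : Measurable e') (hee : ∀ v, e' (e v) = v) :
    ν.map (fun w => (e (V w), X w)) = ν.map (fun w => e (V w)) ⊗ₘ (κ.comap e' he') := by
  ext s hs
  have hs' : MeasurableSet ((fun q : F × 𝒳 => (e q.1, q.2)) ⁻¹' s) := hs.preimage (by fun_prop)
  have h : ν.map (fun w => (V w, X w)) ((fun q : F × 𝒳 => (e q.1, q.2)) ⁻¹' s)
      = (ν.map V ⊗ₘ κ) ((fun q : F × 𝒳 => (e q.1, q.2)) ⁻¹' s) := by rw [hκ]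
  rw [Measure.map_apply (by fun_prop) hs', Measure.compProd_apply hs',
    lintegral_map (Kernel.measurable_kernel_prodMk_left hs') hV] at h
  rw [Measure.map_apply (by fun_prop) hs, Measure.compProd_apply hs,
    lintegral_map (Kernel.measurable_kernel_prodMk_left hs) (by fun_prop)]
  simp only [Kernel.comap_apply, hee]
  exact h

/-- Bandwidths for samples of size `n + 1` in dimension `d`. -/
structure IsBandwidth (d : ℕ) (h : ℕ → ℝ) : Prop where
  pos : ∀ n, 0 < h n
  tendsto_zero : Tendsto h atTop (𝓝 0)
  large : Tendsto (fun n : ℕ => ((n : ℝ) + 1) * h n ^ d) atTop atTop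

lemma finrank_EYZ : Module.finrank ℝ (EYZ dY dZ) = dY + dZ := by
  rw [(WithLp.linearEquiv 2 ℝ (E dY × E dZ)).finrank_eq]
  simp

/-- The conditional laws of `X` given `(Y, Z)` and given `Z` for `(X, Y, Z) ∼ ν`, in the case where
`(Y, Z)` has a density and the conditional laws do not charge spheres. -/
structure IsDiffuseDisintegration (ν : Measure (Obs dX dY dZ))
    (κ : Kernel (E dY × E dZ) (E dX)) (Q : Kernel (E dZ) (E dX)) : Prop where
  absolutelyContinuous : ν.map (fun w => w.2) ≪ volume
  map_yz : ν.map (fun w => (w.2, w.1)) = ν.map (fun w => w.2) ⊗ₘ κ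
  map_z : ν.map (fun w => (w.2.2, w.1)) = ν.map (fun w => w.2.2) ⊗ₘ Q
  sphere_yz : ∀ᵐ v ∂(ν.map fun w => w.2), ∀ u r, κ v (Metric.sphere u r) = 0
  sphere_z : ∀ᵐ v ∂(ν.map fun w => w.2), ∀ u r, Q v.2 (Metric.sphere u r) = 0

section Consistency

variable {ν : Measure (Obs dX dY dZ)} [IsProbabilityMeasure ν]
  {κ : Kernel (E dY × E dZ) (E dX)} [IsMarkovKernel κ] {Q : Kernel (E dZ) (E dX)}
  [IsMarkovKernel Q] {a : E dY × E dZ → ℝ} {K₁ K₂ : ℝ → ℝ} {h₁ h₂ : ℕ → ℝ}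

/-- Fixing the `s`-th observation at `w` makes the evaluation point deterministic. Both estimates
then converge weakly in probability, and ball divergence is continuous at their diffuse limits. -/
lemma ae_tendsto_zetaTerm (hν : IsDiffuseDisintegration ν κ Q) (hK₁ : IsLocalProfile K₁)
    (hK₂ : IsLocalProfile K₂) (hK₁pos : 0 < ∫ u : EYZ dY dZ, K₁ ‖u‖)
    (hK₂pos : 0 < ∫ u : E dZ, K₂ ‖u‖) (hh₁ : IsBandwidth (dY + dZ) h₁) (hh₂ : IsBandwidth dZ h₂) :
    ∀ᵐ w ∂ν, ∀ s : ∀ n : ℕ, Fin (n + 1),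
      Tendsto (fun x : Σ n : ℕ, (Fin (n + 1) → Obs dX dY dZ) =>
          zetaTerm a K₁ K₂ (h₁ x.1) (h₂ x.1) (Function.update x.2 (s x.1) w) (s x.1))
        (probFilter fun n => Measure.pi fun _ : Fin (n + 1) => ν)
        (𝓝 (ballDivergence (κ w.2) (Q w.2.2) * a w.2)) := by
  have hX : Measurable fun w : Obs dX dY dZ => w.1 := measurable_fst
  have hto : Measurable (WithLp.toLp 2 : E dY × E dZ → EYZ dY dZ) := by fun_prop
  have hof : Measurable (WithLp.ofLp : EYZ dY dZ → E dY × E dZ) := by fun_prop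
  have hV₁ : Measurable fun w : Obs dX dY dZ => (WithLp.toLp 2 w.2 : EYZ dY dZ) := by fun_prop
  have hV₂ : Measurable fun w : Obs dX dY dZ => w.2.2 := by fun_prop
  have hac₁ : ν.map (fun w : Obs dX dY dZ => (WithLp.toLp 2 w.2 : EYZ dY dZ)) ≪ volume := by
    have h := hν.absolutelyContinuous.map hto
    rwa [Measure.map_map hto measurable_snd, (WithLp.volume_preserving_toLp _ _).map_eq] at h
  have hac₂ : ν.map (fun w : Obs dX dY dZ => w.2.2) ≪ volume := by
    have h := hν.absolutelyContinuous.map (measurable_snd (α := E dY) (β := E dZ))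
    rw [Measure.map_map measurable_snd measurable_snd] at h
    exact h.trans Measure.quasiMeasurePreserving_snd.absolutelyContinuous
  have hκ₁ := map_prodMk_eq_compProd_comap (V := fun w : Obs dX dY dZ => w.2) (by fun_prop) hX
    hν.map_yz hto hof (fun v => rfl)
  have e₁ := ae_tendsto_kernel_estimate ν hV₁ hac₁ hX hκ₁ hK₁ hK₁pos hh₁.pos hh₁.tendsto_zero
    (by rw [finrank_EYZ]; exact hh₁.large)
  have e₂ := ae_tendsto_kernel_estimate ν hV₂ hac₂ hX hν.map_z hK₂ hK₂pos hh₂.pos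
    hh₂.tendsto_zero (by rw [finrank_euclideanSpace_fin]; exact hh₂.large)
  filter_upwards [e₁, e₂, ae_of_ae_map measurable_snd.aemeasurable hν.sphere_yz,
    ae_of_ae_map measurable_snd.aemeasurable hν.sphere_z] with w e₁ e₂ hs₁ hs₂ s
  obtain ⟨p₁, t₁⟩ := e₁ s w
  obtain ⟨p₂, t₂⟩ := e₂ s w
  have h := tendsto_ballDivergence t₁ t₂ (by rw [toProb_coe]; exact hs₁)
    (by rw [toProb_coe]; exact hs₂)
  rw [toProb_coe, toProb_coe] at h
  refine (h.mul_const (a w.2)).congr' ?_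
  filter_upwards [p₁, p₂] with x q₁ q₂
  rw [toProb_coe, toProb_coe]
  simp only [zetaTerm, estXgivenYZ, estXgivenZ, Function.update_self]

lemma enorm_sub_le_of_mem_Icc {x y B : ℝ} (hx : x ∈ Set.Icc 0 B) (hy : y ∈ Set.Icc 0 B) :
    ‖x - y‖ₑ ≤ ENNReal.ofReal B := by
  rw [Real.enorm_eq_ofReal_abs]
  refine ENNReal.ofReal_le_ofReal ?_
  rw [abs_le]
  constructor <;> linarith [hx.1, hx.2, hy.1, hy.2]

variable (κ Q a) in
/-- The population counterpart of the contribution of an observation to the statistic. -/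
def zetaLimit (w : Obs dX dY dZ) : ℝ := ballDivergence (κ w.2) (Q w.2.2) * a w.2

lemma measurable_zetaLimit (ha : Measurable a) : Measurable (zetaLimit κ Q a) := by
  have h := measurable_ballDivergence_kernel
    (κ.comap (fun w : Obs dX dY dZ => w.2) (by fun_prop)) (Q.comap (fun w => w.2.2) (by fun_prop))
  exact h.mul (ha.comp measurable_snd)

lemma zetaLimit_mem_Icc {C : ℝ} (ha0 : ∀ v, 0 ≤ a v) (haC : ∀ v, a v ≤ C)
    (w : Obs dX dY dZ) : zetaLimit κ Q a w ∈ Set.Icc 0 (2 * C) :=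
  ⟨mul_nonneg (ballDivergence_nonneg _ _) (ha0 _),
    mul_le_mul (ballDivergence_le_two (by simp) (by simp)) (haC _) (ha0 _) zero_le_two⟩

/-- The `s`-th observation is both evaluation point and sample member. Replacing it by an
independent `w` separates the roles: bounded convergence in probability handles the sample for fixed
`w`, and dominated convergence then handles `w`. -/
lemma tendsto_lintegral_zetaTerm_sub (hν : IsDiffuseDisintegration ν κ Q)
    (hK₁ : IsLocalProfile K₁) (hK₂ : IsLocalProfile K₂) (hK₁pos : 0 < ∫ u : EYZ dY dZ, K₁ ‖u‖)
    (hK₂pos : 0 < ∫ u : E dZ, K₂ ‖u‖) (hh₁ : IsBandwidth (dY + dZ) h₁) (hh₂ : IsBandwidth dZ h₂)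
    (ha : Measurable a) {C : ℝ} (ha0 : ∀ v, 0 ≤ a v) (haC : ∀ v, a v ≤ C)
    (s : ∀ n : ℕ, Fin (n + 1)) :
    Tendsto (fun n : ℕ => ∫⁻ D, ‖zetaTerm a K₁ K₂ (h₁ n) (h₂ n) D (s n)
      - zetaLimit κ Q a (D (s n))‖ₑ ∂(Measure.pi fun _ : Fin (n + 1) => ν)) atTop (𝓝 0) := by
  set G : ∀ n : ℕ, (Fin (n + 1) → Obs dX dY dZ) → ℝ≥0∞ := fun n D =>
    ‖zetaTerm a K₁ K₂ (h₁ n) (h₂ n) D (s n) - zetaLimit κ Q a (D (s n))‖ₑ with hG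
  have hGm : ∀ n, Measurable (G n) := fun n =>
    ((measurable_zetaTerm ha hK₁.measurable hK₂.measurable hK₁.nonneg hK₂.nonneg _ _ _).sub
      ((measurable_zetaLimit ha).comp (measurable_pi_apply _))).enorm
  have hGB : ∀ n D, G n D ≤ ENNReal.ofReal (2 * C) := fun n D =>
    enorm_sub_le_of_mem_Icc (zetaTerm_mem_Icc hK₁.nonneg hK₂.nonneg _ _ ha0 haC _ _)
      (zetaLimit_mem_Icc ha0 haC _)
  clear_value G
  have hum : ∀ n : ℕ, Measurable fun q : Obs dX dY dZ × (Fin (n + 1) → Obs dX dY dZ) =>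
      Function.update q.2 (s n) q.1 := fun n => by
    refine measurable_pi_iff.2 fun i => ?_
    by_cases hi : i = s n
    · subst hi; simpa using measurable_fst
    · simp only [Function.update_of_ne hi]; fun_prop
  have heq : ∀ n : ℕ, ∫⁻ D, G n D ∂(Measure.pi fun _ : Fin (n + 1) => ν)
      = ∫⁻ w, ∫⁻ D, G n (Function.update D (s n) w) ∂(Measure.pi fun _ : Fin (n + 1) => ν) ∂ν := by
    intro n
    conv_lhs => rw [← map_update_prod_pi ν (s n)]
    rw [lintegral_map (hGm n) (hum n)]
    exact lintegral_prod _ ((hGm n).comp (hum n)).aemeasurable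
  have hdom := tendsto_lintegral_of_dominated_convergence (μ := ν)
    (F := fun (n : ℕ) w =>
      ∫⁻ D, G n (Function.update D (s n) w) ∂(Measure.pi fun _ : Fin (n + 1) => ν))
    (f := fun _ => 0) (fun _ => ENNReal.ofReal (2 * C))
    (fun n => Measurable.lintegral_prod_right' ((hGm n).comp (hum n)))
    (fun n => ae_of_all _ fun w => (lintegral_mono fun D => hGB n _).trans (by simp))
    (by rw [lintegral_const]; exact ENNReal.mul_ne_top ENNReal.ofReal_ne_top (measure_ne_top _ _))
    ?_
  · simp only [lintegral_zero] at hdom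
    exact hdom.congr fun n => (heq n).symm.trans (by rw [hG])
  · filter_upwards [ae_tendsto_zetaTerm (a := a) hν hK₁ hK₂ hK₁pos hK₂pos hh₁ hh₂] with w hw
    have h := ((hw s).sub_const (zetaLimit κ Q a w)).enorm
    rw [zetaLimit, sub_self, enorm_zero] at h
    have h' : Tendsto (fun x : Σ n : ℕ, (Fin (n + 1) → Obs dX dY dZ) =>
        G x.1 (Function.update x.2 (s x.1) w))
        (probFilter fun n => Measure.pi fun _ : Fin (n + 1) => ν) (𝓝 0) :=
      h.congr fun x => by simp only [hG, zetaLimit, Function.update_self]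
    exact tendsto_lintegral_of_tendsto_probFilter
      (f := fun x : Σ n : ℕ, (Fin (n + 1) → Obs dX dY dZ) => G x.1 (Function.update x.2 (s x.1) w))
      (P := fun n => Measure.pi fun _ : Fin (n + 1) => ν)
      ENNReal.ofReal_ne_top (fun x => hGB _ _) h'

/-- The statistic is close in mean to the empirical mean of its population counterpart. -/
lemma tendsto_lintegral_zetaHat_sub (hν : IsDiffuseDisintegration ν κ Q)
    (hK₁ : IsLocalProfile K₁) (hK₂ : IsLocalProfile K₂) (hK₁pos : 0 < ∫ u : EYZ dY dZ, K₁ ‖u‖)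
    (hK₂pos : 0 < ∫ u : E dZ, K₂ ‖u‖) (hh₁ : IsBandwidth (dY + dZ) h₁) (hh₂ : IsBandwidth dZ h₂)
    (ha : Measurable a) {C : ℝ} (ha0 : ∀ v, 0 ≤ a v) (haC : ∀ v, a v ≤ C) :
    Tendsto (fun n : ℕ => ∫⁻ D, ‖zetaHat a K₁ K₂ (h₁ n) (h₂ n) D
      - (1 / ((n : ℝ) + 1)) * ∑ s, zetaLimit κ Q a (D s)‖ₑ
        ∂(Measure.pi fun _ : Fin (n + 1) => ν)) atTop (𝓝 0) := by
  set I : ∀ n : ℕ, Fin (n + 1) → ℝ≥0∞ := fun n s => ∫⁻ D, ‖zetaTerm a K₁ K₂ (h₁ n) (h₂ n) D s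
      - zetaLimit κ Q a (D s)‖ₑ ∂(Measure.pi fun _ : Fin (n + 1) => ν) with hI
  -- The average over `s` is bounded by its worst term. The index may vary with `n`, which is why
  -- the preceding lemmas allow an arbitrary choice `s`.
  have hmax : ∀ n, ∃ s, ∀ s', I n s' ≤ I n s := fun n => Finite.exists_max (I n)
  choose s hs using hmax
  refine tendsto_of_tendsto_of_tendsto_of_le_of_le tendsto_const_nhds
    (tendsto_lintegral_zetaTerm_sub hν hK₁ hK₂ hK₁pos hK₂pos hh₁ hh₂ ha ha0 haC s)
    (fun _ => zero_le) fun n => ?_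
  have hn : ENNReal.ofReal (1 / ((n : ℝ) + 1)) * ((n + 1 : ℕ) : ℝ≥0∞) = 1 := by
    rw [← ENNReal.ofReal_natCast, ← ENNReal.ofReal_mul (by positivity)]
    push_cast
    rw [one_div_mul_cancel (by positivity), ENNReal.ofReal_one]
  calc ∫⁻ D, ‖zetaHat a K₁ K₂ (h₁ n) (h₂ n) D
      - (1 / ((n : ℝ) + 1)) * ∑ s, zetaLimit κ Q a (D s)‖ₑ ∂(Measure.pi fun _ : Fin (n + 1) => ν)
      ≤ ∫⁻ D, ENNReal.ofReal (1 / ((n : ℝ) + 1)) * ∑ s, ‖zetaTerm a K₁ K₂ (h₁ n) (h₂ n) D s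
        - zetaLimit κ Q a (D s)‖ₑ ∂(Measure.pi fun _ : Fin (n + 1) => ν) := by
        refine lintegral_mono fun D => ?_
        rw [zetaHat_eq_sum_zetaTerm]
        push_cast
        rw [← mul_sub, ← Finset.sum_sub_distrib, enorm_mul,
          Real.enorm_of_nonneg (r := 1 / ((n : ℝ) + 1)) (by positivity)]
        gcongr
        exact enorm_sum_le _ _
    _ = ENNReal.ofReal (1 / ((n : ℝ) + 1)) * ∑ s, I n s := by
        rw [lintegral_const_mul' _ _ ENNReal.ofReal_ne_top, lintegral_finsetSum]
        intro s _
        exact ((measurable_zetaTerm ha hK₁.measurable hK₂.measurable hK₁.nonneg hK₂.nonneg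
          _ _ _).sub ((measurable_zetaLimit ha).comp (measurable_pi_apply _))).enorm
    _ ≤ ENNReal.ofReal (1 / ((n : ℝ) + 1)) * (((n + 1 : ℕ) : ℝ≥0∞) * I n (s n)) := by
        gcongr
        refine (Finset.sum_le_card_nsmul _ _ _ fun s' _ => hs n s').trans ?_
        simp
    _ = I n (s n) := by rw [← mul_assoc, hn, one_mul]

/-- The statistic is consistent for the weighted conditional ball divergence. -/
theorem tendsto_zetaHat (hν : IsDiffuseDisintegration ν κ Q)
    (hK₁ : IsLocalProfile K₁) (hK₂ : IsLocalProfile K₂) (hK₁pos : 0 < ∫ u : EYZ dY dZ, K₁ ‖u‖)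
    (hK₂pos : 0 < ∫ u : E dZ, K₂ ‖u‖) (hh₁ : IsBandwidth (dY + dZ) h₁) (hh₂ : IsBandwidth dZ h₂)
    (ha : Measurable a) {C : ℝ} (ha0 : ∀ v, 0 ≤ a v) (haC : ∀ v, a v ≤ C) :
    Tendsto (fun x : Σ n : ℕ, (Fin (n + 1) → Obs dX dY dZ) =>
        zetaHat a K₁ K₂ (h₁ x.1) (h₂ x.1) x.2)
      (probFilter fun n => Measure.pi fun _ : Fin (n + 1) => ν)
      (𝓝 (∫ w, zetaLimit κ Q a w ∂ν)) := by
  have hlln := tendsto_empirical_mean ν (f := fun _ => zetaLimit κ Q a) (B := fun _ => 2 * C)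
    (fun _ => measurable_zetaLimit ha) (fun _ w => (zetaLimit_mem_Icc ha0 haC w).1)
    (fun _ w => (zetaLimit_mem_Icc ha0 haC w).2) tendsto_const_nhds
    (tendsto_const_nhds.div_atTop
      (tendsto_atTop_add_const_right _ _ tendsto_natCast_atTop_atTop))
  have hdiff : Tendsto (fun x : Σ n : ℕ, (Fin (n + 1) → Obs dX dY dZ) =>
      zetaHat a K₁ K₂ (h₁ x.1) (h₂ x.1) x.2
        - (1 / ((x.1 : ℝ) + 1)) * ∑ s, zetaLimit κ Q a (x.2 s))
      (probFilter fun n => Measure.pi fun _ : Fin (n + 1) => ν) (𝓝 0) := by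
    have hL := tendsto_lintegral_zetaHat_sub hν hK₁ hK₂ hK₁pos hK₂pos hh₁ hh₂ ha ha0 haC
    rw [Metric.tendsto_nhds]
    intro ε hε
    rw [eventually_probFilter]
    have hε' : ENNReal.ofReal ε ≠ 0 := by simpa using hε
    have hlim := ENNReal.Tendsto.div_const hL (b := ENNReal.ofReal ε) (Or.inr hε')
    rw [ENNReal.zero_div] at hlim
    refine tendsto_of_tendsto_of_tendsto_of_le_of_le tendsto_const_nhds hlim
      (fun _ => zero_le) fun n => ?_
    refine (measure_mono ?_).trans (meas_ge_le_lintegral_div ?_ hε' ENNReal.ofReal_ne_top)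
    · intro D hD
      simp only [Real.dist_eq, sub_zero, not_lt, Set.mem_ofPred_eq] at hD ⊢
      rw [Real.enorm_eq_ofReal_abs]
      exact ENNReal.ofReal_le_ofReal hD
    · exact ((measurable_zetaHat ha hK₁.measurable hK₂.measurable hK₁.nonneg hK₂.nonneg _ _).sub
        ((Finset.measurable_sum _ fun s _ =>
          (measurable_zetaLimit ha).comp (measurable_pi_apply s)).const_mul _)).enorm.aemeasurable
  simpa using hdiff.add hlln

end Consistency

/-! ### Kernels, bandwidths and diffuse conditional laws from the assumptions -/

lemma KernelAssumption.isLocalProfile {d : ℕ} {K : ℝ → ℝ} (hK : KernelAssumption d K)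
    (hm : Measurable K) : IsLocalProfile K where
  measurable := hm
  nonneg := hK.nonneg
  bounded := hK.bounded
  support := by
    obtain ⟨R, hR, h⟩ := hK.compactSupport.exists_pos_le_norm
    exact ⟨R, hR, fun t ht => h t (by rw [Real.norm_of_nonneg (hR.trans ht).le]; exact ht.le)⟩

/-- A radial integral is the same in isometric Euclidean spaces, so the normalisation on `E d`
transfers to `EYZ dY dZ`. -/
lemma KernelAssumption.integral_pos {F : Type*} [NormedAddCommGroup F] [InnerProductSpace ℝ F]
    [FiniteDimensional ℝ F] [MeasurableSpace F] [BorelSpace F] {d : ℕ} {K : ℝ → ℝ}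
    (hK : KernelAssumption d K) (hd : Module.finrank ℝ F = d) : 0 < ∫ u : F, K ‖u‖ := by
  subst hd
  let e := (stdOrthonormalBasis ℝ F).repr
  have h := e.measurePreserving.integral_comp e.toHomeomorph.measurableEmbedding
    (fun u : E (Module.finrank ℝ F) => K ‖u‖)
  simp only [LinearIsometryEquiv.norm_map] at h
  rw [h, hK.integral_eq_one]
  exact one_pos

/-- The quotient of `n * h ^ (d + 4)` by `n * h ^ d` is `h ^ 4`, which forces `h` to zero even when
`d = 0`. -/
lemma isBandwidth_of_tendsto {d : ℕ} {h : ℕ → ℝ} (hpos : ∀ n, 0 < h n)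
    (hlarge : Tendsto (fun n : ℕ => (n : ℝ) * h n ^ d) atTop atTop)
    (hsmall : Tendsto (fun n : ℕ => (n : ℝ) * h n ^ (d + 4)) atTop (𝓝 0)) :
    IsBandwidth d fun n => h (n + 1) where
  pos n := hpos _
  large := by
    refine (hlarge.comp (tendsto_add_atTop_nat 1)).congr fun n => ?_
    simp
  tendsto_zero := by
    have h4 : Tendsto (fun n => h n ^ 4) atTop (𝓝 0) := by
      refine (hsmall.div_atTop hlarge).congr' ?_
      filter_upwards [eventually_gt_atTop 0] with n hn
      have h1 : (0 : ℝ) < n := by exact_mod_cast hn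
      have h2 := hpos n
      rw [pow_add]
      field_simp
    have h0 : Tendsto h atTop (𝓝 0) := by
      rw [Metric.tendsto_nhds]
      intro ε hε
      filter_upwards [h4.eventually (gt_mem_nhds (pow_pos hε 4))] with n hn
      rw [Real.dist_eq, sub_zero, abs_of_pos (hpos n)]
      exact lt_of_pow_lt_pow_left₀ 4 hε.le hn
    exact h0.comp (tendsto_add_atTop_nat 1)

lemma ae_absolutelyContinuous_of_compProd {F : Type*} [MeasurableSpace F] {m : Measure F}
    [SigmaFinite m] {d : ℕ} {ρ : Measure F} [IsFiniteMeasure ρ] {κ : Kernel F (E d)}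
    [IsMarkovKernel κ] (h : ρ ⊗ₘ κ ≪ m.prod volume) : ∀ᵐ v ∂ρ, κ v ≪ volume := by
  -- Lebesgue measure is exchanged for an equivalent finite measure, giving a finite constant kernel
  -- to compare `κ` with.
  have h1 : ρ ⊗ₘ κ ≪ m ⊗ₘ Kernel.const F (volume : Measure (E d)).toFinite := by
    rw [Measure.compProd_const]
    exact h.trans (Measure.AbsolutelyContinuous.rfl.prod (absolutelyContinuous_toFinite _))
  filter_upwards [h1.kernel_of_compProd] with v hv
  exact hv.trans (toFinite_absolutelyContinuous _)

/-- Radius `0` is included, so points are null as well; in dimension `0` that would fail, the single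
point having full mass. -/
lemma sphere_null_of_absolutelyContinuous {d : ℕ} (hd : 0 < d) {P : Measure (E d)}
    (hP : P ≪ volume) (u : E d) (r : ℝ) : P (Metric.sphere u r) = 0 := by
  obtain ⟨k, rfl⟩ := Nat.exists_eq_succ_of_ne_zero hd.ne'
  exact hP (Measure.addHaar_sphere _ _ _)

/-- By Tonelli, the mass of the observations at which the marginal density of `(Y, Z)` vanishes is
the integral of that density over its own zero set. -/
lemma IsWeight.ae_pos {μ : Measure (Obs dX dY dZ)} {p : Obs dX dY dZ → ℝ}
    (hp : HasDensity μ p) {a : E dY × E dZ → ℝ} (ha : IsWeight p a) : ∀ᵐ w ∂μ, 0 < a w.2 := by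
  have hpm : Measurable fun w => ENNReal.ofReal (p w) := hp.measurable.ennreal_ofReal
  set N : Set (Obs dX dY dZ) := {w | ∫⁻ x, ENNReal.ofReal (p (x, w.2)) = 0} with hN
  have hNm : MeasurableSet N := by
    have h : Measurable fun v : E dY × E dZ => ∫⁻ x, ENNReal.ofReal (p (x, v)) :=
      hpm.lintegral_prod_left'
    exact (h.comp measurable_snd) (measurableSet_singleton 0)
  have h0 : μ N = 0 := by
    rw [hp.eq_withDensity, withDensity_apply _ hNm, ← lintegral_indicator hNm]
    change ∫⁻ w, N.indicator (fun w => ENNReal.ofReal (p w)) w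
      ∂((volume : Measure (E dX)).prod (volume : Measure (E dY × E dZ))) = 0
    rw [lintegral_prod_symm _ (hpm.indicator hNm).aemeasurable]
    refine (lintegral_congr fun v => ?_).trans lintegral_zero
    by_cases hv : ∫⁻ x, ENNReal.ofReal (p (x, v)) = 0
    · refine le_antisymm ((lintegral_mono fun x => Set.indicator_le_self _ _ _).trans hv.le) zero_le
    · have : ∀ x, (x, v) ∉ N := fun x => hv
      simp [this]
  filter_upwards [measure_eq_zero_iff_ae_notMem.1 h0] with w hw
  exact ha.pos w.2.1 w.2.2 hw

/-- The conditional law of `X` given `(Y, Z)`. -/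
def condLawYZ (μ : Measure (Obs dX dY dZ)) [IsProbabilityMeasure μ] :
    Kernel (E dY × E dZ) (E dX) :=
  (μ.map fun w => (w.2, w.1)).condKernel

instance (μ : Measure (Obs dX dY dZ)) [IsProbabilityMeasure μ] :
    IsMarkovKernel (condLawYZ μ) := by
  unfold condLawYZ; infer_instance

section

variable {μ : Measure (Obs dX dY dZ)} [IsProbabilityMeasure μ] {Q : Kernel (E dZ) (E dX)}
  [IsMarkovKernel Q]

lemma map_yzx_eq_compProd_condLawYZ :
    μ.map (fun w => (w.2, w.1)) = μ.map (fun w => w.2) ⊗ₘ condLawYZ μ := by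
  have h := (μ.map fun w => (w.2, w.1)).disintegrate
    (μ.map fun w => (w.2, w.1)).condKernel
  rw [Measure.fst, Measure.map_map (by fun_prop) (by fun_prop)] at h
  exact h.symm

lemma isDiffuseDisintegration_condLawYZ (hd : 0 < dX) (hμ : μ ≪ volume) (hQ : IsCondLawXZ μ Q) :
    IsDiffuseDisintegration μ (condLawYZ μ) Q where
  absolutelyContinuous :=
    (hμ.map measurable_snd).trans Measure.quasiMeasurePreserving_snd.absolutelyContinuous
  map_yz := map_yzx_eq_compProd_condLawYZ
  map_z := hQ.map_eq
  sphere_yz := by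
    have h : μ.map (fun w => (w.2, w.1)) ≪ (volume : Measure (E dY × E dZ)).prod volume :=
      (hμ.map measurable_swap).trans
        (Measure.measurePreserving_swap (μ := (volume : Measure (E dX)))
          (ν := (volume : Measure (E dY × E dZ)))).quasiMeasurePreserving.absolutelyContinuous
    rw [map_yzx_eq_compProd_condLawYZ] at h
    filter_upwards [ae_absolutelyContinuous_of_compProd h] with v hv
    exact sphere_null_of_absolutelyContinuous hd hv
  sphere_z := by
    have hq : Measure.QuasiMeasurePreserving (fun w : Obs dX dY dZ => (w.2.2, w.1)) volume
        ((volume : Measure (E dZ)).prod volume) := by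
      have h1 : Measure.QuasiMeasurePreserving (Prod.map Prod.snd id : (E dY × E dZ) × E dX → _)
          ((volume : Measure (E dY × E dZ)).prod (volume : Measure (E dX)))
          ((volume : Measure (E dZ)).prod (volume : Measure (E dX))) := by
        refine ⟨by fun_prop, ?_⟩
        rw [← Measure.map_prod_map _ _ measurable_snd measurable_id, Measure.map_id]
        exact Measure.quasiMeasurePreserving_snd.absolutelyContinuous.prod
          Measure.AbsolutelyContinuous.rfl
      exact h1.comp Measure.measurePreserving_swap.quasiMeasurePreserving
    have h := (hμ.map hq.measurable).trans hq.absolutelyContinuous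
    rw [hQ.map_eq] at h
    have h2 := ae_absolutelyContinuous_of_compProd h
    have h3 : μ.map (fun w => w.2.2) = (μ.map (fun w => w.2)).map Prod.snd := by
      rw [Measure.map_map measurable_snd measurable_snd]; rfl
    rw [h3] at h2
    filter_upwards [ae_of_ae_map measurable_snd.aemeasurable h2] with v hv
    exact sphere_null_of_absolutelyContinuous hd hv

lemma isDiffuseDisintegration_resampledLaw {κ : Kernel (E dY × E dZ) (E dX)}
    (hμ : IsDiffuseDisintegration μ κ Q) :
    IsDiffuseDisintegration (resampledLaw μ Q) (Q.comap Prod.snd measurable_snd) Q := by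
  have hs := hμ.sphere_z
  rw [← map_snd_resampledLaw μ Q] at hs
  exact ⟨by rw [map_snd_resampledLaw]; exact hμ.absolutelyContinuous, map_yzx_resampledLaw μ Q,
    map_zx_resampledLaw μ Q, hs, hs⟩

/-- Excludes under the alternative the one dimension in which absolutely continuous laws charge
spheres. -/
lemma condIndep_of_dim_eq_zero (hQ : IsCondLawXZ μ Q) (hd : dX = 0) : CondIndep μ := by
  subst hd
  rw [condIndep_iff_resampledLaw_eq hQ]
  ext s hs
  rw [resampledLaw_apply _ _ hs, ← lintegral_indicator_one hs]
  refine lintegral_congr fun w => ?_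
  have h : ∀ x : E 0, ((x, w.2) ∈ s ↔ w ∈ s) := fun x => by
    rw [Subsingleton.elim x w.1]
  by_cases hw : w ∈ s <;> simp [h, hw]

lemma condIndep_of_condLawYZ_ae_eq (hQ : IsCondLawXZ μ Q)
    (h : ∀ᵐ v ∂(μ.map fun w => w.2), condLawYZ μ v = Q v.2) : CondIndep μ := by
  rw [condIndep_iff_resampledLaw_eq hQ]
  have h2 : (resampledLaw μ Q).map (fun w => (w.2, w.1)) = μ.map (fun w => (w.2, w.1)) := by
    rw [map_yzx_resampledLaw, map_snd_resampledLaw, map_yzx_eq_compProd_condLawYZ]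
    exact (Measure.compProd_congr (κ := condLawYZ μ)
      (η := Q.comap Prod.snd measurable_snd) h).symm
  have h3 := congrArg (Measure.map Prod.swap) h2
  rw [Measure.map_map (by fun_prop) (by fun_prop), Measure.map_map (by fun_prop) (by fun_prop)]
    at h3
  exact (Measure.map_id.symm.trans h3).trans Measure.map_id

/-- If the integral were zero, its nonnegative integrand would vanish almost everywhere. As the
weight is almost surely positive, the ball divergence would vanish, the two conditional laws would
agree, and conditional independence would follow. -/
lemma integral_zetaLimit_pos {p : Obs dX dY dZ → ℝ} (hp : HasDensity μ p)
    (hμ : IsDiffuseDisintegration μ (condLawYZ μ) Q) (hQ : IsCondLawXZ μ Q)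
    {a : E dY × E dZ → ℝ} (ha : IsWeight p a) (hci : ¬ CondIndep μ) :
    0 < ∫ w, zetaLimit (condLawYZ μ) Q a w ∂μ := by
  obtain ⟨C, hC⟩ := ha.bounded
  have hmem := zetaLimit_mem_Icc (κ := condLawYZ μ) (Q := Q) ha.nonneg hC
  have hnn : ∀ w, 0 ≤ zetaLimit (condLawYZ μ) Q a w := fun w => (hmem w).1
  have hint : Integrable (zetaLimit (condLawYZ μ) Q a) μ :=
    Integrable.of_bound (measurable_zetaLimit ha.measurable).aestronglyMeasurable (2 * C)
      (ae_of_all _ fun w => by rw [Real.norm_of_nonneg (hnn w)]; exact (hmem w).2)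
  refine lt_of_le_of_ne (integral_nonneg hnn) fun h0 => hci ?_
  refine condIndep_of_condLawYZ_ae_eq hQ ?_
  have hbm : Measurable fun v : E dY × E dZ => ballDivergence (condLawYZ μ v) (Q v.2) :=
    measurable_ballDivergence_kernel (condLawYZ μ) (Q.comap Prod.snd measurable_snd)
  have hb : ∀ᵐ v ∂(μ.map fun w => w.2), ballDivergence (condLawYZ μ v) (Q v.2) = 0 := by
    refine (ae_map_iff measurable_snd.aemeasurable (hbm (measurableSet_singleton 0))).2 ?_
    filter_upwards [(integral_eq_zero_iff_of_nonneg hnn hint).1 h0.symm, ha.ae_pos hp]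
      with w hw hpos
    exact (mul_eq_zero.1 hw).resolve_right hpos.ne'
  filter_upwards [hb, hμ.sphere_yz] with v hv hs
  exact eq_of_ballDivergence_eq_zero (fun u => by simpa using hs u 0) hv

end

/-! ### Power of the test -/

lemma crtLaw_map_fst (μ : Measure (Obs dX dY dZ)) [IsProbabilityMeasure μ]
    (Q : Kernel (E dZ) (E dX)) [IsMarkovKernel Q] (n M : ℕ) :
    (crtLaw μ Q n M).map Prod.fst = Measure.pi fun _ : Fin n => μ :=
  Measure.fst_compProd _ _

lemma crtLaw_map_replaceX (μ : Measure (Obs dX dY dZ)) [IsProbabilityMeasure μ]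
    (Q : Kernel (E dZ) (E dX)) [IsMarkovKernel Q] (n M : ℕ) (j : Fin M) :
    (crtLaw μ Q n M).map (fun ω => replaceX ω.1 (ω.2 j))
      = Measure.pi fun _ : Fin n => resampledLaw μ Q := by
  rw [← map_replaceX_compProd_resample]
  have h : (crtLaw μ Q n M).map (fun ω => (ω.1, ω.2 j))
      = (Measure.pi fun _ : Fin n => μ) ⊗ₘ resample Q n := by
    ext s hs
    have hm : Measurable fun ω : (Fin n → Obs dX dY dZ) × (Fin M → Fin n → E dX) =>
      (ω.1, ω.2 j) := by fun_prop
    rw [Measure.map_apply hm hs, crtLaw, Measure.compProd_apply (hm hs),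
      Measure.compProd_apply hs]
    refine lintegral_congr fun D => ?_
    exact (measurePreserving_eval (fun _ : Fin M => resample Q n D) j).measure_preimage
      (measurable_prodMk_left hs).nullMeasurableSet
  rw [← h, Measure.map_map measurable_replaceX (by fun_prop)]
  rfl

/-- If the statistic exceeds a threshold on the data and stays below it on each resample, then the
test rejects. -/
lemma crtLaw_compl_pCRT_lt_le (μ : Measure (Obs dX dY dZ)) [IsProbabilityMeasure μ]
    (Q : Kernel (E dZ) (E dX)) [IsMarkovKernel Q] {n M : ℕ} {T : (Fin n → Obs dX dY dZ) → ℝ}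
    (hT : Measurable T) {α : ℝ} (hα : 0 < α) (hM : (1 - α) / α < M) (c : ℝ) :
    crtLaw μ Q n M {ω | pCRT T ω < α}ᶜ ≤ (Measure.pi fun _ : Fin n => μ) {D | ¬ c < T D}
      + M * (Measure.pi fun _ : Fin n => resampledLaw μ Q) {D | ¬ T D < c} := by
  have hj : ∀ j : Fin M, Measurable
      fun ω : (Fin n → Obs dX dY dZ) × (Fin M → Fin n → E dX) => replaceX ω.1 (ω.2 j) :=
    fun j => measurable_replaceX.comp (measurable_fst.prodMk (by fun_prop))
  have hsub : {ω : (Fin n → Obs dX dY dZ) × (Fin M → Fin n → E dX) | pCRT T ω < α}ᶜ ⊆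
      (Prod.fst ⁻¹' {D | ¬ c < T D}) ∪
        ⋃ j : Fin M, (fun ω => replaceX ω.1 (ω.2 j)) ⁻¹' {D | ¬ T D < c} := by
    intro ω hω
    by_contra hc
    simp only [Set.mem_union, Set.mem_iUnion, Set.mem_preimage, Set.mem_ofPred_eq, not_or,
      not_exists, not_not] at hc
    refine hω ?_
    have h0 : (∑ j : Fin M, if T (replaceX ω.1 (ω.2 j)) ≥ T ω.1 then (1 : ℝ) else 0) = 0 :=
      Finset.sum_eq_zero fun j _ => if_neg (not_le.2 ((hc.2 j).trans hc.1))
    simp only [Set.mem_ofPred_eq, pCRT]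
    rw [h0, div_lt_iff₀ (by positivity)]
    -- The bound on `M` is precisely `1 / (1 + M) < α`, the smallest attainable `p`-value being
    -- below the level.
    rw [div_lt_iff₀ hα] at hM
    linarith
  refine (measure_mono hsub).trans ((measure_union_le _ _).trans (add_le_add ?_ ?_))
  · rw [← crtLaw_map_fst μ Q n M]
    exact (Measure.map_apply measurable_fst (measurableSet_lt measurable_const hT).compl).ge
  · refine (measure_iUnion_fintype_le _ _).trans (le_of_eq ?_)
    have h1 : ∀ j : Fin M, crtLaw μ Q n M ((fun ω => replaceX ω.1 (ω.2 j)) ⁻¹' {D | ¬ T D < c})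
        = (Measure.pi fun _ : Fin n => resampledLaw μ Q) {D | ¬ T D < c} := fun j => by
      rw [← crtLaw_map_replaceX μ Q n M j]
      exact (Measure.map_apply (hj j) (measurableSet_lt hT measurable_const).compl).symm
    rw [Finset.sum_congr rfl fun j _ => h1 j]
    simp only [Finset.sum_const, Finset.card_univ, Fintype.card_fin, nsmul_eq_mul]

end CRT

end

theorem mainTheorem7 {dX dY dZ : ℕ}
    (μ : Measure (CRT.Obs dX dY dZ)) [IsProbabilityMeasure μ]
    (p : CRT.Obs dX dY dZ → ℝ) (hp : CRT.HasDensity μ p)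
    (Q : Kernel (CRT.E dZ) (CRT.E dX)) [IsMarkovKernel Q] (hQ : CRT.IsCondLawXZ μ Q)
    (a : CRT.E dY × CRT.E dZ → ℝ) (ha : CRT.IsWeight p a)
    (K₁ K₂ : ℝ → ℝ) (hK₁m : Measurable K₁) (hK₂m : Measurable K₂)
    (hK₁ : ∀ t, 0 ≤ K₁ t) (hK₂ : ∀ t, 0 ≤ K₂ t)
    (h₁ h₂ : ℕ → ℝ) (hh₁ : ∀ n, 0 < h₁ n) (hh₂ : ∀ n, 0 < h₂ n)
    (α : ℝ) (hα₀ : 0 < α) (hα₁ : α < 1) :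
    (CRT.CondIndep μ → ∀ n M : ℕ,
      CRT.rejectionProb μ Q a K₁ K₂ (h₁ n) (h₂ n) α n M ≤ ENNReal.ofReal α) ∧
    (CRT.DensityAssumption p →
      CRT.KernelAssumption (dY + dZ) K₁ → CRT.KernelAssumption dZ K₂ →
      CRT.BandwidthAssumption (dY + dZ) dZ h₁ h₂ →
      ¬ CRT.CondIndep μ → ∀ M : ℕ, (1 - α) / α < (M : ℝ) →
      Tendsto (fun n : ℕ => CRT.rejectionProb μ Q a K₁ K₂ (h₁ n) (h₂ n) α n M)
        atTop (𝓝 1)) := by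
  have hTm : ∀ (b₁ b₂ : ℝ) (n : ℕ), Measurable fun D : Fin n → CRT.Obs dX dY dZ =>
      CRT.zetaHat a K₁ K₂ b₁ b₂ D := fun b₁ b₂ n =>
    CRT.measurable_zetaHat ha.measurable hK₁m hK₂m hK₁ hK₂ b₁ b₂
  refine ⟨fun hci n M => CRT.crtLaw_pCRT_lt_le ((CRT.condIndep_iff_resampledLaw_eq hQ).1 hci)
    (hTm _ _ _) hα₀.le, fun _ hA₁ hA₂ hB hci M hM => ?_⟩
  have hd : 0 < dX := Nat.pos_of_ne_zero fun h => hci (CRT.condIndep_of_dim_eq_zero hQ h)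
  have hac : μ ≪ volume := by
    rw [hp.eq_withDensity]; exact withDensity_absolutelyContinuous _ _
  have hdis := CRT.isDiffuseDisintegration_condLawYZ hd hac hQ
  have hdis' := CRT.isDiffuseDisintegration_resampledLaw hdis
  have hb₁ := CRT.isBandwidth_of_tendsto hh₁ hB.large₁ hB.small₁
  have hb₂ := CRT.isBandwidth_of_tendsto hh₂ hB.large₂ hB.small₂
  have hI₁ : 0 < ∫ u : CRT.EYZ dY dZ, K₁ ‖u‖ := hA₁.integral_pos CRT.finrank_EYZ
  have hI₂ : 0 < ∫ u : CRT.E dZ, K₂ ‖u‖ := hA₂.integral_pos finrank_euclideanSpace_fin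
  obtain ⟨C, hC⟩ := ha.bounded
  have hconv := CRT.tendsto_zetaHat hdis (hA₁.isLocalProfile hK₁m) (hA₂.isLocalProfile hK₂m) hI₁
    hI₂ hb₁ hb₂ ha.measurable ha.nonneg hC
  have hconv' := CRT.tendsto_zetaHat hdis' (hA₁.isLocalProfile hK₁m) (hA₂.isLocalProfile hK₂m) hI₁
    hI₂ hb₁ hb₂ ha.measurable ha.nonneg hC
  have hpos := CRT.integral_zetaLimit_pos hp hdis hQ ha hci
  -- On resampled data both conditional laws are `Q`, and a law has ball divergence zero from
  -- itself.
  have hzero : ∫ w, CRT.zetaLimit (Q.comap Prod.snd measurable_snd) Q a w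
      ∂(CRT.resampledLaw μ Q) = 0 := by
    simp [CRT.zetaLimit, CRT.ballDivergence_self]
  rw [hzero] at hconv'
  set c := ∫ w, CRT.zetaLimit (CRT.condLawYZ μ) Q a w ∂μ with hc
  have hup := CRT.eventually_probFilter.1 (hconv.eventually (lt_mem_nhds (half_lt_self hpos)))
  have hlow := CRT.eventually_probFilter.1 (hconv'.eventually (gt_mem_nhds (half_pos hpos)))
  have hsum := hup.add (ENNReal.Tendsto.const_mul hlow (Or.inr (ENNReal.natCast_ne_top M)))
  rw [mul_zero, add_zero] at hsum
  -- The consistency results are stated for samples of size `n + 1`, so that an index in `Fin (n +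
  -- 1)` always exists.
  rw [← tendsto_add_atTop_iff_nat 1]
  have hcompl : Tendsto (fun n : ℕ => CRT.crtLaw μ Q (n + 1) M
      {ω | CRT.pCRT (CRT.zetaHat a K₁ K₂ (h₁ (n + 1)) (h₂ (n + 1))) ω < α}ᶜ) atTop (𝓝 0) :=
    tendsto_of_tendsto_of_tendsto_of_le_of_le tendsto_const_nhds hsum (fun _ => zero_le)
      fun n => CRT.crtLaw_compl_pCRT_lt_le μ Q (hTm _ _ _) hα₀ hM (c / 2)
  have hprob : ∀ n : ℕ, IsProbabilityMeasure (CRT.crtLaw μ Q (n + 1) M) := fun n => by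
    unfold CRT.crtLaw; infer_instance
  have h1 := ENNReal.Tendsto.sub (tendsto_const_nhds (x := (1 : ℝ≥0∞))) hcompl
    (Or.inl ENNReal.one_ne_top)
  rw [tsub_zero] at h1
  refine h1.congr fun n => ?_
  have hm : MeasurableSet {ω : (Fin (n + 1) → CRT.Obs dX dY dZ) × (Fin M → Fin (n + 1) → CRT.E dX) |
      CRT.pCRT (CRT.zetaHat a K₁ K₂ (h₁ (n + 1)) (h₂ (n + 1))) ω < α} :=
    measurableSet_lt (CRT.measurable_pCRT (hTm _ _ _)) measurable_const
  rw [← prob_compl_eq_one_sub hm.compl, compl_compl]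
  rfl
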